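/- Let $\mathbb H$ be the quaternions, $\mathbb S=\{I\in\mathbb H:\operatorname{Re}I=0,\ |I|=1\}$, and $\mathbb C_I=\mathbb R+I\mathbb R$ for $I\in\mathbb S$. For $p\in\mathbb H\setminus\{0\}$ let $\arg(p)\in[0,\pi]$ be defined by $\operatorname{Re}p=|p|\cos\arg(p)$. For $s\in\mathbb H\setminus(-\infty,0]$ and $\alpha\in\mathbb R$ put $s^{\alpha}=e^{\alpha\log s}$ with $\log s=\ln|s|+I_s\arccos(\operatorname{Re}(s)/|s|)$, where $I_s=\underline{s}/|\underline{s}|$ and $\underline s$ is the imaginary part of $s$ (for $s>0$ the second term of $\log s$ is $0$). Let $V$ be a two-sided quaternionic Banach space and $\mathcal B(V)$ the Banach space of bounded right linear operators on $V$ with the operator norm; for $q\in\mathbb H$ and $A\in\mathcal B(V)$ put $(qA)v=q(Av)$ and $(Aq)v=A(qv)$. Let $T$ be a closed right linear operator in $V$ with domain $\mathcal D(T)$. For $s\in\mathbb H$ let $\mathcal Q_s(T)=T^2-2\operatorname{Re}(s)T+|s|^2\mathcal I$ with domain $\mathcal D(T^2)$. Let $\rho_S(T)$ be the set of all $s$ for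 which $\mathcal Q_s(T)$ has an inverse in $\mathcal B(V)$, and for $s\in\rho_S(T)$ put $$S_L^{-1}(s,T)=\mathcal Q_s(T)^{-1}\overline s-T\mathcal Q_s(T)^{-1},\qquad S_R^{-1}(s,T)=-(T-\mathcal I\overline s)\mathcal Q_s(T)^{-1}.$$ Assume that $(-\infty,0]\subset\rho_S(T)$ and that there is $M>0$ with $\|S_R^{-1}(s,T)\|\le M/(1+|s|)$ for all $s\in(-\infty,0]$. For $a\in\mathbb R$ and $\vartheta\in(0,\pi)$ let $\Sigma(\vartheta,a)=\{a\}\cup\{s\in\mathbb H\setminus\{a\}:\arg(s-a)\ge\vartheta\}$. An admissible path in $\mathbb C_I$, $I\in\mathbb S$, is a piecewise continuously differentiable path $\Gamma:\mathbb R\to\mathbb C_I$ for which there are $a_0>0$ and $0<\theta_0<\theta<\pi$ such that * $\Sigma(\theta_0,a_0)\subset\rho_S(T)$, and $(1+|s|)\|S_R^{-1}(s,T)\|$ and $(1+|s|)\|S_L^{-1}(s,T)\|$ are bounded on $\Sigma(\theta_0,a_0)$; * $\Gamma$ takes its values in $(\Sigma(\theta_0,a_0)\cap\mathbb C_I)\setminus(-\infty,0]$;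 * $\Gamma$ goes from $\infty e^{I\theta}$ to $\infty e^{-I\theta}$, that is, $|\Gamma(t)|\to\infty$ as $t\to\pm\infty$, $\Gamma(t)/|\Gamma(t)|\to e^{I\theta}$ as $t\to-\infty$ and $\Gamma(t)/|\Gamma(t)|\to e^{-I\theta}$ as $t\to+\infty$. Write $ds_I=-I\,ds$; an integral over $\Gamma$ is the limit in $\mathcal B(V)$ of the integrals over $\Gamma|_{[b,c]}$ as $b\to-\infty$ and $c\to+\infty$. **Proposition.** Let $\alpha>0$. Admissible paths exist, and for every $I\in\mathbb S$ and every admissible path $\Gamma$ in $\mathbb C_I$ the integral $$T^{-\alpha}:=\frac1{2\pi}\int_\Gamma s^{-\alpha}\,ds_I\,S_R^{-1}(s,T)$$ converges, and its value in $\mathcal B(V)$ does not depend on $I$ and $\Gamma$. For every $I\in\mathbb S$ and every admissible path $\Gamma$ in $\mathbb C_I$ one also has $$T^{-\alpha}=\frac1{2\pi}\int_\Gamma S_L^{-1}(s,T)\,ds_I\,s^{-\alpha},$$ where this integral converges as well. -/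

import Mathlib

open scoped Quaternion Topology
open Filter Set MeasureTheory

set_option linter.unusedSectionVars false

noncomputable section

namespace QuatFrac

/-! ### Scalars -/

/-- The sphere of imaginary units of the quaternions. -/
def imaginaryUnits : Set ℍ := {I | I.re = 0 ∧ ‖I‖ = 1}

/-- The complex plane `ℂ_I = ℝ + I ℝ`. -/
def slicePlane (I : ℍ) : Set ℍ := {s | ∃ x y : ℝ, s = (x : ℍ) + y • I}

/-- The closed half line `(-∞, 0]` inside the quaternions. -/
def nonposReals : Set ℍ := {s | ∃ x : ℝ, x ≤ 0 ∧ s = (x : ℍ)}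

/-- For `p ≠ 0`, the number `θ ∈ [0, π]` with `p = |p| e^{θ I_p}`, that is,
`Re p = |p| cos θ`. -/
def arg (p : ℍ) : ℝ := Real.arccos (p.re / ‖p‖)

/-- The closed sector `{s : arg (s - a) ≥ θ}` with vertex `a`, the vertex included. -/
def closedSector (θ a : ℝ) : Set ℍ := {s | s = (a : ℍ) ∨ θ ≤ arg (s - (a : ℍ))}

/-- The logarithm `log s = ln |s| + I_s arccos (s₀ / |s|)` for `s ∉ (-∞, 0]`, where
`I_s = Im s / |Im s|`.  For `s > 0` the second term vanishes, as it should. -/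
def qlog (s : ℍ) : ℍ :=
  ((Real.log ‖s‖ : ℝ) : ℍ) + Real.arccos (s.re / ‖s‖) • (‖s.im‖⁻¹ • s.im)

/-- The fractional power `s ^ α = e^{α log s}` for `s ∉ (-∞, 0]`. -/
def qpow (s : ℍ) (α : ℝ) : ℍ := NormedSpace.exp (α • qlog s)

/-! ### Bounded and closed right linear operators

A two-sided quaternionic Banach space is a complete normed group `V` with commuting actions of
`ℍ` (left multiplication) and `ℍᵐᵒᵖ` (right multiplication), both with `|q v| = |q| |v|`, which
induce the same real scalar multiplication. -/

section Operators

variable (V : Type*) [NormedAddCommGroup V] [NormedSpace ℝ V]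
  [Module ℍ V] [Module ℍᵐᵒᵖ V] [SMulCommClass ℍ ℍᵐᵒᵖ V]
  [IsScalarTower ℝ ℍ V] [IsScalarTower ℝ ℍᵐᵒᵖ V]
  [NormSMulClass ℍ V] [NormSMulClass ℍᵐᵒᵖ V]

/-- The Banach algebra of all bounded right linear operators on `V`, with the operator norm. -/
def BoundedOp : Subalgebra ℝ (V →L[ℝ] V) where
  carrier := {A | ∀ (q : ℍᵐᵒᵖ) (v : V), A (q • v) = q • A v}
  mul_mem' := by
    intro A B hA hB q v
    change ∀ (q : ℍᵐᵒᵖ) (v : V), A (q • v) = q • A v at hA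
    change ∀ (q : ℍᵐᵒᵖ) (v : V), B (q • v) = q • B v at hB
    simp [hA, hB]
  add_mem' := by
    intro A B hA hB q v
    change ∀ (q : ℍᵐᵒᵖ) (v : V), A (q • v) = q • A v at hA
    change ∀ (q : ℍᵐᵒᵖ) (v : V), B (q • v) = q • B v at hB
    simp [hA, hB]
  algebraMap_mem' := by
    intro r q v
    simp [Algebra.algebraMap_eq_smul_one, smul_comm r q v]

variable {V}

theorem isClosed_boundedOp : IsClosed (BoundedOp V : Set (V →L[ℝ] V)) := by
  have h : (BoundedOp V : Set (V →L[ℝ] V)) =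
      ⋂ (q : ℍᵐᵒᵖ), ⋂ (v : V), {A | A (q • v) = q • A v} := by
    ext A
    simp only [mem_iInter]
    rfl
  rw [h]
  have hsmul : ∀ q : ℍᵐᵒᵖ, Continuous fun v : V => q • v := by
    intro q
    refine (LipschitzWith.of_dist_le_mul (K := ‖q‖₊) fun x y => ?_).continuous
    rw [dist_eq_norm, dist_eq_norm, ← smul_sub, norm_smul]
    rfl
  refine isClosed_iInter fun q => isClosed_iInter fun v => ?_
  refine isClosed_eq (by fun_prop) ((hsmul q).comp (by fun_prop))

instance [CompleteSpace V] : CompleteSpace (BoundedOp V) :=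
  isClosed_boundedOp.completeSpace_coe

/-- The operator `v ↦ q v`.  The scalar multiplications of the two-sided module of bounded right
linear operators are `q A = leftMul q * A` and `A q = A * leftMul q`. -/
def leftMul (q : ℍ) : BoundedOp V :=
  ⟨LinearMap.mkContinuous
    { toFun := fun v => q • v
      map_add' := smul_add q
      map_smul' := fun r v => smul_comm q r v } ‖q‖ (fun v => (norm_smul q v).le),
   fun p v => smul_comm q p v⟩

variable (V) in
/-- A closed (in general unbounded) right linear operator with domain in `V`. -/
structure ClosedOp where
  /-- the operator, defined on a right linear subspace of `V` -/
  toPMap : V →ₗ.[ℍᵐᵒᵖ] V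
  isClosed_graph : IsClosed (toPMap.graph : Set (V × V))

/-- The domain `{v ∈ D(T) : T v ∈ D(T)}` of `T²`. -/
def domainSq (T : ClosedOp V) : Submodule ℍᵐᵒᵖ V where
  carrier := {v | ∃ h : v ∈ T.toPMap.domain, T.toPMap ⟨v, h⟩ ∈ T.toPMap.domain}
  add_mem' := by
    rintro v w ⟨hv, hv'⟩ ⟨hw, hw'⟩
    refine ⟨add_mem hv hw, ?_⟩
    have h := T.toPMap.map_add ⟨v, hv⟩ ⟨w, hw⟩
    have h2 := add_mem hv' hw'
    rw [← h] at h2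
    exact h2
  zero_mem' := by
    refine ⟨zero_mem _, ?_⟩
    have h := T.toPMap.map_zero
    have h2 := zero_mem T.toPMap.domain
    rw [← h] at h2
    exact h2
  smul_mem' := by
    rintro q v ⟨hv, hv'⟩
    refine ⟨Submodule.smul_mem _ q hv, ?_⟩
    have h := T.toPMap.map_smul q ⟨v, hv⟩
    have h2 := Submodule.smul_mem _ q hv'
    rw [← h] at h2
    exact h2

/-- `T² v - 2 Re(s) T v + |s|² v` for `v` in the domain of `T²`. -/
def quadOp (T : ClosedOp V) (s : ℍ) (v : domainSq T) : V :=
  T.toPMap ⟨T.toPMap ⟨v, v.2.fst⟩, v.2.snd⟩ - (2 * s.re) • T.toPMap ⟨v, v.2.fst⟩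
    + (‖s‖ ^ 2) • (v : V)

/-- `B` is a bounded inverse of `T² - 2 Re(s) T + |s|²`, an operator with domain `D(T²)`. -/
structure IsPseudoResolvent (T : ClosedOp V) (s : ℍ) (B : BoundedOp V) : Prop where
  mem_domain : ∀ w : V, B.1 w ∈ domainSq T
  right_inv : ∀ w : V, quadOp T s ⟨B.1 w, mem_domain w⟩ = w
  left_inv : ∀ v : domainSq T, B.1 (quadOp T s v) = v

/-- The `S`-resolvent set. -/
def resolventSet (T : ClosedOp V) : Set ℍ := {s | ∃ B : BoundedOp V, IsPseudoResolvent T s B}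

variable [CompleteSpace V]

/-- The bounded operator `T B` if `B` is bounded and maps `V` into the domain of `T`
(it is bounded by the closed graph theorem). -/
def compOp (T : ClosedOp V) (B : BoundedOp V) (h : ∀ w, B.1 w ∈ T.toPMap.domain) :
    BoundedOp V :=
  ⟨ContinuousLinearMap.ofSeqClosedGraph (𝕜 := ℝ)
    (g :=
      { toFun := fun w => T.toPMap ⟨B.1 w, h w⟩
        map_add' := fun v w => by
          rw [← LinearPMap.map_add]
          congr 1
          exact Subtype.ext (map_add B.1 v w)
        map_smul' := fun r w => by
          have e : ∀ x : V, (r • (1 : ℍᵐᵒᵖ)) • x = r • x := fun x => by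
            rw [smul_assoc, one_smul]
          simp only [RingHom.id_apply]
          rw [← e (T.toPMap ⟨B.1 w, h w⟩), ← LinearPMap.map_smul]
          congr 1
          refine Subtype.ext ?_
          rw [Submodule.coe_smul, e]
          exact map_smul B.1 r w })
    (by
      intro u x y hu hy
      have hB : Tendsto (fun n => B.1 (u n)) atTop (𝓝 (B.1 x)) := (B.1.continuous.tendsto x).comp hu
      have hmem : ((B.1 x, y) : V × V) ∈ (T.toPMap.graph : Set (V × V)) := by
        refine T.isClosed_graph.mem_of_tendsto (hB.prodMk_nhds hy) (Eventually.of_forall fun n => ?_)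
        exact T.toPMap.mem_graph ⟨B.1 (u n), h (u n)⟩
      obtain ⟨z, hz1, hz2⟩ := (LinearPMap.mem_graph_iff _).1 hmem
      have hz : z = ⟨B.1 x, h x⟩ := Subtype.ext hz1
      change y = T.toPMap ⟨B.1 x, h x⟩
      rw [← hz]
      exact hz2.symm),
   fun q v => by
    change T.toPMap ⟨B.1 (q • v), h (q • v)⟩ = q • T.toPMap ⟨B.1 v, h v⟩
    rw [← LinearPMap.map_smul]
    congr 1
    exact Subtype.ext (B.2 q v)⟩

@[simp]
theorem compOp_apply (T : ClosedOp V) (B : BoundedOp V) (h : ∀ w, B.1 w ∈ T.toPMap.domain)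
    (w : V) : (compOp T B h).1 w = T.toPMap ⟨B.1 w, h w⟩ := rfl

open Classical in
/-- The pseudo-resolvent `(T² - 2 Re(s) T + |s|²)⁻¹` for `s` in the `S`-resolvent set
(and `0` otherwise). -/
def pseudoRes (T : ClosedOp V) (s : ℍ) : BoundedOp V :=
  if h : s ∈ resolventSet T then h.choose else 0

theorem pseudoRes_mem (T : ClosedOp V) (s : ℍ) (w : V) :
    (pseudoRes T s).1 w ∈ T.toPMap.domain := by
  unfold pseudoRes
  split_ifs with h
  · exact (h.choose_spec.mem_domain w).fst
  · exact zero_mem _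

/-- The left `S`-resolvent operator. -/
def resolventL (T : ClosedOp V) (s : ℍ) : BoundedOp V :=
  pseudoRes T s * leftMul (star s) - compOp T (pseudoRes T s) (pseudoRes_mem T s)

/-- The right `S`-resolvent operator. -/
def resolventR (T : ClosedOp V) (s : ℍ) : BoundedOp V :=
  -(compOp T (pseudoRes T s) (pseudoRes_mem T s) - leftMul (star s) * pseudoRes T s)

/-! ### Admissible paths and fractional powers -/

/-- The closed sector with vertex `a₀ > 0` and angle `θ₀ ∈ (0, π)` lies in the `S`-resolvent set
and both `S`-resolvents are `O(1 / (1 + |s|))` on it. -/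
structure IsResolventSector (T : ClosedOp V) (a₀ θ₀ : ℝ) : Prop where
  vertex_pos : 0 < a₀
  angle_mem : θ₀ ∈ Ioo 0 Real.pi
  subset_resolventSet : closedSector θ₀ a₀ ⊆ resolventSet T
  bound : ∃ M : ℝ, 0 < M ∧ ∀ s ∈ closedSector θ₀ a₀,
    ‖resolventR T s‖ ≤ M / (1 + ‖s‖) ∧ ‖resolventL T s‖ ≤ M / (1 + ‖s‖)

/-- Piecewise continuously differentiable: every parameter has a closed left and a closed right
neighbourhood on which `γ` is `C¹` up to the end points.  By compactness every bounded interval is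
then a union of finitely many intervals on which `γ` is `C¹`. -/
def PiecewiseC1 (γ : ℝ → ℍ) : Prop :=
  ∀ t : ℝ, ∃ ε : ℝ, 0 < ε ∧ ContDiffOn ℝ 1 γ (Icc (t - ε) t) ∧ ContDiffOn ℝ 1 γ (Icc t (t + ε))

/-- `γ` is an admissible path in `ℂ_I` for the operator `T`: a piecewise smooth path in
`ℂ_I \ (-∞, 0]` inside a sector as above, which goes from `∞ e^{I θ}` to `∞ e^{-I θ}`
for some `θ ∈ (θ₀, π)`. -/
def IsAdmissiblePath (T : ClosedOp V) (I : ℍ) (γ : ℝ → ℍ) : Prop :=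
  I ∈ imaginaryUnits ∧ PiecewiseC1 γ ∧ ∃ a₀ θ₀ θ : ℝ,
    IsResolventSector T a₀ θ₀ ∧ θ ∈ Ioo θ₀ Real.pi ∧
    (∀ t, γ t ∈ (closedSector θ₀ a₀ ∩ slicePlane I) \ nonposReals) ∧
    Tendsto (fun t => ‖γ t‖) atBot atTop ∧ Tendsto (fun t => ‖γ t‖) atTop atTop ∧
    Tendsto (fun t => ‖γ t‖⁻¹ • γ t) atBot (𝓝 ((Real.cos θ : ℍ) + Real.sin θ • I)) ∧
    Tendsto (fun t => ‖γ t‖⁻¹ • γ t) atTop (𝓝 ((Real.cos θ : ℍ) - Real.sin θ • I))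

/-- `(1 / 2π) ∫ s^{-α} ds_I S_R⁻¹(s, T)` over the part of the path with parameters between
`ab.1` and `ab.2`, where `ds_I = -I ds`. -/
def rightIntegral (T : ClosedOp V) (I : ℍ) (γ : ℝ → ℍ) (α : ℝ) (ab : ℝ × ℝ) : BoundedOp V :=
  (2 * Real.pi)⁻¹ • ∫ t in ab.1..ab.2,
    leftMul (qpow (γ t) (-α)) * leftMul (-I * deriv γ t) * resolventR T (γ t)

/-- `(1 / 2π) ∫ S_L⁻¹(s, T) ds_I s^{-α}` over the part of the path with parameters between
`ab.1` and `ab.2`, where `ds_I = -I ds`. -/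
def leftIntegral (T : ClosedOp V) (I : ℍ) (γ : ℝ → ℍ) (α : ℝ) (ab : ℝ × ℝ) : BoundedOp V :=
  (2 * Real.pi)⁻¹ • ∫ t in ab.1..ab.2,
    resolventL T (γ t) * leftMul (-I * deriv γ t) * leftMul (qpow (γ t) (-α))

open Classical in
/-- The fractional power `T^{-α} = (1 / 2π) ∫_Γ s^{-α} ds_I S_R⁻¹(s, T)`: one chooses an admissible
path `Γ`, and the integral over the whole path is the limit, in operator norm, of the integrals
over its compact parts. -/
def fracPow (T : ClosedOp V) (α : ℝ) : BoundedOp V :=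
  if h : ∃ p : ℍ × (ℝ → ℍ), IsAdmissiblePath T p.1 p.2 then
    limUnder (atBot ×ˢ atTop) (rightIntegral T h.choose.1 h.choose.2 α)
  else 0

end Operators

end QuatFrac

end

namespace QuatFrac

/-! ### Resolvent equations for the pseudo-resolvent -/

section Resolvent

variable {V : Type*} [NormedAddCommGroup V] [NormedSpace ℝ V]
  [Module ℍ V] [Module ℍᵐᵒᵖ V] [SMulCommClass ℍ ℍᵐᵒᵖ V]
  [IsScalarTower ℝ ℍ V] [IsScalarTower ℝ ℍᵐᵒᵖ V]
  [NormSMulClass ℍ V] [NormSMulClass ℍᵐᵒᵖ V]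

/-! Write P for the inverse of Q_s(T) and K = T P. Both depend only on Re s and |s|. For s = x + I y
the right S-resolvent is (x P - K) - I (y P). If I commuted with P and K, this would be the
classical resolvent of T at s. Commutation turns out not to be needed. The first resolvent equation,
split into real and imaginary parts, is a pair of identities with real coefficients between x P - K
and y P (`IsSlicePair.resolvent_identity`), and I can be put back on one side only. Hence the right
S-resolvent is holomorphic on `ℂ_I` for the complex structure on the operators given by left
multiplication, and the left S-resolvent for the one given by right multiplication.

The integrand is thus a Banach-space valued holomorphic function of size O(|s|^(-1-α)) on a slit
sector. That sector is star-shaped about its vertex, so there is a primitive. The decay gives the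
primitive one limit at infinity in the upper half and one in the lower half, and every path integral
in the sector is the difference of the two (`exists_tendsto_integral_sectorPath`).

Independence of I and the equality of left and right integrals come from pairing conjugate points of
a symmetric wedge. If c is the scalar factor at a point, X = x P - K and Y = y P, then c (X - I Y) +
c̄ (X + I Y) = 2 Re(c) X + 2 Im(c) Y, with the same value when the scalars stand on the right
(`wedgeForm`). Two sectors are compared through a wedge lying in both (`exists_limit_admissible`).

Admissible paths exist because the Neumann series at x ≤ 0 converges on a ball of radius
proportional to 1 + |x|, and these balls cover a sector with positive vertex
(`exists_isResolventSector`). -/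

theorem BoundedOp.ext {A B : BoundedOp V} (h : ∀ v, A.1 v = B.1 v) : A = B :=
  Subtype.ext (ContinuousLinearMap.ext h)

@[simp] theorem BoundedOp.mul_apply (A B : BoundedOp V) (v : V) :
    (A * B).1 v = A.1 (B.1 v) := rfl

@[simp] theorem BoundedOp.add_apply (A B : BoundedOp V) (v : V) :
    (A + B).1 v = A.1 v + B.1 v := rfl

@[simp] theorem BoundedOp.sub_apply (A B : BoundedOp V) (v : V) :
    (A - B).1 v = A.1 v - B.1 v := rfl

@[simp] theorem BoundedOp.smul_apply (r : ℝ) (A : BoundedOp V) (v : V) :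
    (r • A).1 v = r • A.1 v := rfl

@[simp] theorem BoundedOp.one_apply (v : V) : (1 : BoundedOp V).1 v = v := rfl

@[simp] theorem leftMul_apply (q : ℍ) (v : V) : (leftMul q : BoundedOp V).1 v = q • v := rfl

/-- A right linear operator is real homogeneous. -/
theorem ClosedOp.map_real_smul (T : ClosedOp V) (r : ℝ) (v : T.toPMap.domain) :
    ∃ h : r • (v : V) ∈ T.toPMap.domain, T.toPMap ⟨r • (v : V), h⟩ = r • T.toPMap v := by
  have e : ∀ x : V, (r • (1 : ℍᵐᵒᵖ)) • x = r • x := fun x => by rw [smul_assoc, one_smul]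
  have h : r • (v : V) ∈ T.toPMap.domain := by
    rw [← e]; exact Submodule.smul_mem _ _ v.2
  refine ⟨h, ?_⟩
  rw [← e (T.toPMap v), ← LinearPMap.map_smul]
  congr 1
  exact Subtype.ext (by rw [Submodule.coe_smul, e])

/-- `T v = w` as a relation. -/
def ClosedOp.Maps (T : ClosedOp V) (v w : V) : Prop := ∃ h : v ∈ T.toPMap.domain, T.toPMap ⟨v, h⟩ = w

namespace ClosedOp.Maps

variable {T : ClosedOp V} {v w v' w' : V}

theorem add (h : T.Maps v w) (h' : T.Maps v' w') : T.Maps (v + v') (w + w') := by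
  obtain ⟨h, rfl⟩ := h
  obtain ⟨h', rfl⟩ := h'
  exact ⟨add_mem h h', T.toPMap.map_add ⟨v, h⟩ ⟨v', h'⟩⟩

theorem smul (r : ℝ) (h : T.Maps v w) : T.Maps (r • v) (r • w) := by
  obtain ⟨h, rfl⟩ := h
  exact T.map_real_smul r ⟨v, h⟩

theorem sub (h : T.Maps v w) (h' : T.Maps v' w') : T.Maps (v - v') (w - w') := by
  simpa [sub_eq_add_neg] using h.add (h'.smul (-1))

theorem unique (h : T.Maps v w) (h' : T.Maps v w') : w = w' := by
  obtain ⟨h, rfl⟩ := h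
  obtain ⟨h', rfl⟩ := h'
  rfl

end ClosedOp.Maps

theorem mem_domainSq_iff {T : ClosedOp V} {v : V} :
    v ∈ domainSq T ↔ ∃ w u, T.Maps v w ∧ T.Maps w u :=
  ⟨fun ⟨h, h'⟩ => ⟨_, _, ⟨h, rfl⟩, ⟨h', rfl⟩⟩, fun ⟨_, _, ⟨h, hw⟩, ⟨h', _⟩⟩ => ⟨h, hw ▸ h'⟩⟩

theorem quadOp_eq {T : ClosedOp V} (s : ℍ) {v w u : V} (h : T.Maps v w) (h' : T.Maps w u)
    (hv : v ∈ domainSq T) :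
    quadOp T s ⟨v, hv⟩ = u - (2 * s.re) • w + (‖s‖ ^ 2) • v := by
  obtain ⟨h, rfl⟩ := h
  obtain ⟨h', rfl⟩ := h'
  rfl

/-- Pseudo-resolvents in terms of the relation `T v = w`. -/
theorem isPseudoResolvent_iff {T : ClosedOp V} {s : ℍ} {B : BoundedOp V} :
    IsPseudoResolvent T s B ↔
      (∀ w, ∃ u, T.Maps (B.1 w) u ∧ T.Maps u (w + (2 * s.re) • u - (‖s‖ ^ 2) • B.1 w)) ∧
      ∀ v w u, T.Maps v w → T.Maps w u → B.1 (u - (2 * s.re) • w + (‖s‖ ^ 2) • v) = v := by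
  constructor
  · intro h
    refine ⟨fun w => ?_, fun v w u hv hw => ?_⟩
    · obtain ⟨u, t, hu, ht⟩ := mem_domainSq_iff.1 (h.mem_domain w)
      refine ⟨u, hu, ?_⟩
      have := h.right_inv w
      rw [quadOp_eq s hu ht] at this
      convert ht using 1
      linear_combination (norm := module) -this
    · have hd : v ∈ domainSq T := mem_domainSq_iff.2 ⟨w, u, hv, hw⟩
      have := h.left_inv ⟨v, hd⟩
      rwa [quadOp_eq s hv hw] at this
  · rintro ⟨h1, h2⟩
    have hd : ∀ w, B.1 w ∈ domainSq T := fun w => by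
      obtain ⟨u, hu, ht⟩ := h1 w
      exact mem_domainSq_iff.2 ⟨_, _, hu, ht⟩
    refine ⟨hd, fun w => ?_, fun v => ?_⟩
    · obtain ⟨u, hu, ht⟩ := h1 w
      rw [quadOp_eq s hu ht]; abel
    · obtain ⟨v, hv⟩ := v
      obtain ⟨w, u, hw, hu⟩ := mem_domainSq_iff.1 hv
      rw [quadOp_eq s hw hu]
      exact h2 _ _ _ hw hu

theorem IsPseudoResolvent.unique {T : ClosedOp V} {s t : ℍ} {B C : BoundedOp V}
    (hB : IsPseudoResolvent T s B) (hC : IsPseudoResolvent T t C)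
    (hre : s.re = t.re) (hn : ‖s‖ = ‖t‖) : B = C := by
  refine BoundedOp.ext fun w => ?_
  obtain ⟨u, hu, ht⟩ := (isPseudoResolvent_iff.1 hB).1 w
  have := (isPseudoResolvent_iff.1 hC).2 _ _ _ hu ht
  rw [← this, hre, hn]
  congr 1; abel

variable [CompleteSpace V]

/-- The bounded operator `T (T² - 2 Re(s) T + |s|²)⁻¹`. -/
noncomputable def opRes (T : ClosedOp V) (s : ℍ) : BoundedOp V :=
  compOp T (pseudoRes T s) (pseudoRes_mem T s)

theorem isPseudoResolvent_pseudoRes {T : ClosedOp V} {s : ℍ} (hs : s ∈ resolventSet T) :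
    IsPseudoResolvent T s (pseudoRes T s) := by
  unfold pseudoRes
  rw [dif_pos hs]
  exact hs.choose_spec

theorem maps_opRes (T : ClosedOp V) (s : ℍ) (w : V) :
    T.Maps ((pseudoRes T s).1 w) ((opRes T s).1 w) := ⟨pseudoRes_mem T s w, rfl⟩

variable {T : ClosedOp V} {s t : ℍ}

theorem maps_maps_opRes (hs : s ∈ resolventSet T) (w : V) :
    T.Maps ((opRes T s).1 w)
      (w + (2 * s.re) • (opRes T s).1 w - (‖s‖ ^ 2) • (pseudoRes T s).1 w) := by
  obtain ⟨u, hu, ht⟩ := (isPseudoResolvent_iff.1 (isPseudoResolvent_pseudoRes hs)).1 w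
  rwa [hu.unique (maps_opRes T s w)] at ht

theorem pseudoRes_apply_quad (hs : s ∈ resolventSet T) {v w u : V} (h : T.Maps v w)
    (h' : T.Maps w u) :
    (pseudoRes T s).1 (u - (2 * s.re) • w + (‖s‖ ^ 2) • v) = v :=
  (isPseudoResolvent_iff.1 (isPseudoResolvent_pseudoRes hs)).2 _ _ _ h h'

/-- The pseudo-resolvent commutes with the operator. -/
theorem opRes_apply_of_maps (hs : s ∈ resolventSet T) {v w : V} (h : T.Maps v w) :
    (opRes T s).1 v = (pseudoRes T s).1 w := by
  have h1 := maps_opRes T s v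
  have h2 := maps_maps_opRes hs v
  -- The right-hand side of `h2` is again in the domain of T, so K v lies in D(T²), and its image
  -- under Q_s(T) is w.
  have h3 := (h.add (h2.smul (2 * s.re))).sub (h1.smul (‖s‖ ^ 2))
  rw [← pseudoRes_apply_quad hs h2 h3]
  congr 1; abel

theorem pseudoRes_congr (hs : s ∈ resolventSet T) (ht : t ∈ resolventSet T)
    (hre : s.re = t.re) (hn : ‖s‖ = ‖t‖) : pseudoRes T s = pseudoRes T t :=
  (isPseudoResolvent_pseudoRes hs).unique (isPseudoResolvent_pseudoRes ht) hre hn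

theorem pseudoRes_mul_opRes (hs : s ∈ resolventSet T) :
    pseudoRes T s * opRes T t = opRes T s * pseudoRes T t :=
  BoundedOp.ext fun w => (opRes_apply_of_maps hs (maps_opRes T t w)).symm

/-- K_s K_t = P_s T K_t, and T K_t is eliminated with Q_t(T) P_t = 1. Eliminating T² through Q_s
instead gives `opRes_mul_opRes_right`; comparing the two yields `pseudoRes_sub`. -/
theorem opRes_mul_opRes_left (hs : s ∈ resolventSet T) (ht : t ∈ resolventSet T) :
    opRes T s * opRes T t = pseudoRes T s + (2 * t.re) • (pseudoRes T s * opRes T t)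
      - (‖t‖ ^ 2) • (pseudoRes T s * pseudoRes T t) :=
  BoundedOp.ext fun w => by
    have := opRes_apply_of_maps hs (maps_maps_opRes ht w)
    simpa [map_add, map_sub, map_smul] using this

theorem opRes_mul_opRes_right (hs : s ∈ resolventSet T) (t : ℍ) :
    opRes T s * opRes T t = pseudoRes T t + (2 * s.re) • (pseudoRes T s * opRes T t)
      - (‖s‖ ^ 2) • (pseudoRes T s * pseudoRes T t) :=
  BoundedOp.ext fun w => by
    have h1 := maps_opRes T s ((opRes T t).1 w)
    have h2 := maps_maps_opRes hs ((pseudoRes T t).1 w)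
    rw [← BoundedOp.mul_apply, ← BoundedOp.mul_apply, pseudoRes_mul_opRes hs] at h1
    rw [pseudoRes_mul_opRes hs]
    exact h1.unique h2

theorem pseudoRes_sub (hs : s ∈ resolventSet T) (ht : t ∈ resolventSet T) :
    pseudoRes T s - pseudoRes T t = (2 * (s.re - t.re)) • (pseudoRes T s * opRes T t)
      - (‖s‖ ^ 2 - ‖t‖ ^ 2) • (pseudoRes T s * pseudoRes T t) := by
  have h1 := opRes_mul_opRes_left hs ht
  rw [opRes_mul_opRes_right hs t] at h1
  linear_combination (norm := module) -h1

/-- This is T applied to `pseudoRes_sub`. -/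
theorem opRes_sub (hs : s ∈ resolventSet T) (ht : t ∈ resolventSet T) :
    opRes T s - opRes T t = (2 * (s.re - t.re)) • (opRes T s * opRes T t)
      - (‖s‖ ^ 2 - ‖t‖ ^ 2) • (pseudoRes T s * opRes T t) := by
  refine BoundedOp.ext fun w => ?_
  have h := congrArg (fun A : BoundedOp V => A.1 w) (pseudoRes_sub hs ht)
  have h1 := (maps_opRes T s w).sub (maps_opRes T t w)
  have h2 := ((maps_opRes T s ((opRes T t).1 w)).smul (2 * (s.re - t.re))).sub
    ((maps_opRes T s ((pseudoRes T t).1 w)).smul (‖s‖ ^ 2 - ‖t‖ ^ 2))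
  simp only [BoundedOp.sub_apply, BoundedOp.smul_apply, BoundedOp.mul_apply] at h
  rw [h] at h1
  rw [pseudoRes_mul_opRes hs]
  exact h1.unique h2

theorem resolventR_eq (T : ClosedOp V) (s : ℍ) :
    resolventR T s = leftMul (star s) * pseudoRes T s - opRes T s := by
  unfold resolventR opRes; abel

theorem resolventL_eq (T : ClosedOp V) (s : ℍ) :
    resolventL T s = pseudoRes T s * leftMul (star s) - opRes T s := rfl

/-- A bounded inverse of `1 + E` for the relative perturbation `E` gives a pseudo-resolvent. -/
theorem isPseudoResolvent_of_perturbation (ht : t ∈ resolventSet T) (s : ℍ) (N : BoundedOp V)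
    (hN : (1 + ((2 * (t.re - s.re)) • opRes T t + (‖s‖ ^ 2 - ‖t‖ ^ 2) • pseudoRes T t)) * N = 1)
    (hN' : N * (1 + ((2 * (t.re - s.re)) • opRes T t + (‖s‖ ^ 2 - ‖t‖ ^ 2) • pseudoRes T t)) = 1) :
    IsPseudoResolvent T s (pseudoRes T t * N) := by
  -- On D(T²), Q_s(T) = (1 + E) Q_t(T), where E is the perturbation in `hN`; so P_t N inverts it.
  rw [isPseudoResolvent_iff]
  refine ⟨fun w => ⟨_, maps_opRes T t _, ?_⟩, fun v w u hv hw => ?_⟩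
  · have h := congrArg (fun A : BoundedOp V => A.1 w) hN
    simp only [BoundedOp.add_apply, BoundedOp.smul_apply, BoundedOp.mul_apply,
      BoundedOp.one_apply] at h
    have h1 := maps_maps_opRes ht (N.1 w)
    have h2 : N.1 w + (2 * t.re) • (opRes T t).1 (N.1 w) - (‖t‖ ^ 2) • (pseudoRes T t).1 (N.1 w) =
        w + (2 * s.re) • (opRes T t).1 (N.1 w) - (‖s‖ ^ 2) • (pseudoRes T t).1 (N.1 w) := by
      linear_combination (norm := module) h
    rwa [h2] at h1
  · have h1 := pseudoRes_apply_quad ht hv hw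
    set y := u - (2 * t.re) • w + (‖t‖ ^ 2) • v with hy
    have h2 : (opRes T t).1 y = w := (maps_opRes T t y).unique (h1 ▸ hv)
    have h := congrArg (fun A : BoundedOp V => A.1 y) hN'
    simp only [BoundedOp.add_apply, BoundedOp.smul_apply, BoundedOp.mul_apply,
      BoundedOp.one_apply, h1, h2] at h
    simp only [BoundedOp.mul_apply]
    have h3 : u - (2 * s.re) • w + (‖s‖ ^ 2) • v =
        y + ((2 * (t.re - s.re)) • w + (‖s‖ ^ 2 - ‖t‖ ^ 2) • v) := by
      rw [hy]; module
    rw [h3, h, h1]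

theorem pseudoRes_eq_of_perturbation (ht : t ∈ resolventSet T) (s : ℍ) (N : BoundedOp V)
    (hN : (1 + ((2 * (t.re - s.re)) • opRes T t + (‖s‖ ^ 2 - ‖t‖ ^ 2) • pseudoRes T t)) * N = 1)
    (hN' : N * (1 + ((2 * (t.re - s.re)) • opRes T t + (‖s‖ ^ 2 - ‖t‖ ^ 2) • pseudoRes T t)) = 1) :
    s ∈ resolventSet T ∧ pseudoRes T s = pseudoRes T t * N ∧ opRes T s = opRes T t * N := by
  have h := isPseudoResolvent_of_perturbation ht s N hN hN'
  have hs : s ∈ resolventSet T := ⟨_, h⟩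
  have hP := (isPseudoResolvent_pseudoRes hs).unique h rfl rfl
  refine ⟨hs, hP, BoundedOp.ext fun w => ?_⟩
  have h1 := maps_opRes T s w
  rw [hP] at h1
  exact h1.unique (maps_opRes T t (N.1 w))

/-- Near a point of the resolvent set the pseudo-resolvent is given by a Neumann series. -/
theorem eventually_pseudoRes_eq (ht : t ∈ resolventSet T) :
    ∃ N : ℍ → BoundedOp V, ContinuousAt N t ∧ N t = 1 ∧
      ∀ᶠ s in 𝓝 t, s ∈ resolventSet T ∧ pseudoRes T s = pseudoRes T t * N s ∧
        opRes T s = opRes T t * N s := by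
  set E : ℍ → BoundedOp V := fun s =>
    1 + ((2 * (t.re - s.re)) • opRes T t + (‖s‖ ^ 2 - ‖t‖ ^ 2) • pseudoRes T t) with hE
  have hre : Continuous fun s : ℍ => s.re := Quaternion.continuous_re
  have hEc : Continuous E := by fun_prop
  have hEt : E t = 1 := by simp [hE]
  have hu : IsUnit (E t) := by rw [hEt]; exact isUnit_one
  refine ⟨fun s => Ring.inverse (E s), ?_, by simp [hEt], ?_⟩
  · obtain ⟨u, hu'⟩ := hu
    have := NormedRing.inverse_continuousAt u
    rw [hu'] at this
    exact ContinuousAt.comp (f := E) (x := t) this hEc.continuousAt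
  · have : ∀ᶠ s in 𝓝 t, IsUnit (E s) :=
      hEc.continuousAt.eventually (Units.isOpen.mem_nhds hu)
    filter_upwards [this] with s hs
    exact pseudoRes_eq_of_perturbation ht s _ (Ring.mul_inverse_cancel _ hs)
      (Ring.inverse_mul_cancel _ hs)

theorem isOpen_resolventSet (T : ClosedOp V) : IsOpen (resolventSet T) := by
  rw [isOpen_iff_mem_nhds]
  intro t ht
  obtain ⟨N, -, -, h⟩ := eventually_pseudoRes_eq ht
  exact h.mono fun s hs => hs.1

theorem continuousAt_pseudoRes (ht : t ∈ resolventSet T) : ContinuousAt (pseudoRes T) t := by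
  obtain ⟨N, hN, -, h⟩ := eventually_pseudoRes_eq ht
  exact (continuousAt_const.mul hN).congr (h.mono fun s hs => hs.2.1.symm)

theorem continuousAt_opRes (ht : t ∈ resolventSet T) : ContinuousAt (opRes T) t := by
  obtain ⟨N, hN, -, h⟩ := eventually_pseudoRes_eq ht
  exact (continuousAt_const.mul hN).congr (h.mono fun s hs => hs.2.2.symm)

end Resolvent

end QuatFrac
namespace QuatFrac

/-! ### Quantitative Neumann series -/

section Neumann

variable {A : Type*} [NormedRing A] [NormedAlgebra ℝ A]

theorem norm_mul_le_of_le' {a b : A} {r s : ℝ} (ha : ‖a‖ ≤ r) (hb : ‖b‖ ≤ s) : ‖a * b‖ ≤ r * s :=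
  (norm_mul_le a b).trans (mul_le_mul ha hb (norm_nonneg _) ((norm_nonneg _).trans ha))

/-- The bound is 2 · (1/4) + (1/4)²; what matters is that it is below 1. -/
theorem norm_neumann_perturbation_le {R : A} {m δ d : ℝ} (hR : ‖R‖ ≤ m) (hd : |d| ≤ δ)
    (hδ : δ * m ≤ 1 / 4) : ‖(2 * d) • R + δ ^ 2 • (R * R)‖ ≤ 9 / 16 := by
  have hm0 : 0 ≤ m := (norm_nonneg _).trans hR
  have hδ0 : 0 ≤ δ := (abs_nonneg _).trans hd
  have hRR : ‖R * R‖ ≤ m * m := norm_mul_le_of_le' hR hR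
  calc ‖(2 * d) • R + δ ^ 2 • (R * R)‖ ≤ ‖(2 * d) • R‖ + ‖δ ^ 2 • (R * R)‖ := norm_add_le _ _
    _ ≤ 2 * δ * m + δ ^ 2 * (m * m) := by
      rw [norm_smul, norm_smul, Real.norm_eq_abs, Real.norm_eq_abs, abs_mul, abs_two,
        abs_of_nonneg (sq_nonneg δ)]
      gcongr
    _ ≤ 9 / 16 := by nlinarith [mul_nonneg hδ0 hm0]

/-- The constant is 1 / (1 - 9/16), read off from N = 1 - E N. Only ‖1‖ ≤ 1 is required, so that V =
0 is allowed. -/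
theorem exists_inverse_one_add [CompleteSpace A] (h1 : ‖(1 : A)‖ ≤ 1) {E : A}
    (hE : ‖E‖ ≤ 9 / 16) : ∃ N, (1 + E) * N = 1 ∧ N * (1 + E) = 1 ∧ ‖N‖ ≤ 16 / 7 := by
  have hu : IsUnit (1 + E) := by
    have := isUnit_one_sub_of_norm_lt_one (x := -E) (by rw [norm_neg]; linarith)
    rwa [sub_neg_eq_add] at this
  obtain ⟨N, hN⟩ : ∃ N, N = Ring.inverse (1 + E) := ⟨_, rfl⟩
  have hN1 : (1 + E) * N = 1 := by rw [hN]; exact Ring.mul_inverse_cancel _ hu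
  have hN2 : N * (1 + E) = 1 := by rw [hN]; exact Ring.inverse_mul_cancel _ hu
  refine ⟨N, hN1, hN2, ?_⟩
  have h2 : N = 1 - E * N := by rw [← hN1]; noncomm_ring
  have h3 : ‖N‖ ≤ 1 + 9 / 16 * ‖N‖ := by
    calc ‖N‖ = ‖1 - E * N‖ := by rw [← h2]
      _ ≤ ‖(1 : A)‖ + ‖E * N‖ := norm_sub_le _ _
      _ ≤ 1 + 9 / 16 * ‖N‖ := add_le_add h1 (norm_mul_le_of_le' hE le_rfl)
  linarith

/-- These are the shapes of the two S-resolvents near a real point, and (1/4 + 1) · 16/7 ≤ 4. -/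
theorem norm_neumann_resolvent_le {L R N : A} {m δ : ℝ} (hL : ‖L‖ ≤ δ) (hR : ‖R‖ ≤ m)
    (hN : ‖N‖ ≤ 16 / 7) (hδ : δ * m ≤ 1 / 4) :
    ‖L * (R * R * N) + R * N‖ ≤ 4 * m ∧ ‖R * R * N * L + R * N‖ ≤ 4 * m := by
  have hm0 : 0 ≤ m := (norm_nonneg _).trans hR
  have h1 : ‖R * R * N‖ ≤ m * m * (16 / 7) :=
    norm_mul_le_of_le' (norm_mul_le_of_le' hR hR) hN
  have h2 : ‖R * N‖ ≤ m * (16 / 7) := norm_mul_le_of_le' hR hN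
  constructor
  · refine (norm_add_le_of_le (norm_mul_le_of_le' hL h1) h2).trans ?_
    nlinarith
  · refine (norm_add_le_of_le (norm_mul_le_of_le' h1 hL) h2).trans ?_
    nlinarith

end Neumann

/-! ### From the half line to a sector -/

section Sector

variable {V : Type*} [NormedAddCommGroup V] [NormedSpace ℝ V]
  [Module ℍ V] [Module ℍᵐᵒᵖ V] [SMulCommClass ℍ ℍᵐᵒᵖ V]
  [IsScalarTower ℝ ℍ V] [IsScalarTower ℝ ℍᵐᵒᵖ V]
  [NormSMulClass ℍ V] [NormSMulClass ℍᵐᵒᵖ V]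

theorem norm_leftMul_le (q : ℍ) : ‖(leftMul q : BoundedOp V)‖ ≤ ‖q‖ :=
  ContinuousLinearMap.opNorm_le_bound _ (norm_nonneg q) fun v => (norm_smul q v).le

theorem leftMul_mul (p q : ℍ) : (leftMul (p * q) : BoundedOp V) = leftMul p * leftMul q :=
  BoundedOp.ext fun v => mul_smul p q v

theorem leftMul_add (p q : ℍ) : (leftMul (p + q) : BoundedOp V) = leftMul p + leftMul q :=
  BoundedOp.ext fun v => add_smul p q v

theorem leftMul_real_smul (r : ℝ) (q : ℍ) : (leftMul (r • q) : BoundedOp V) = r • leftMul q :=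
  BoundedOp.ext fun v => smul_assoc r q v

theorem leftMul_one : (leftMul 1 : BoundedOp V) = 1 :=
  BoundedOp.ext fun v => one_smul ℍ v

theorem leftMul_coe (r : ℝ) : (leftMul (r : ℍ) : BoundedOp V) = r • 1 := by
  have : (r : ℍ) = r • (1 : ℍ) := by rw [← Quaternion.coe_mul_eq_smul, mul_one]
  rw [this, leftMul_real_smul, leftMul_one]

theorem norm_one_boundedOp_le : ‖(1 : BoundedOp V)‖ ≤ 1 := by
  simpa [leftMul_one] using norm_leftMul_le (V := V) 1

variable [CompleteSpace V] {T : ClosedOp V}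

theorem resolventR_coe (x : ℝ) :
    resolventR T (x : ℍ) = x • pseudoRes T (x : ℍ) - opRes T (x : ℍ) := by
  rw [resolventR_eq, Quaternion.star_coe, leftMul_coe, smul_mul_assoc, one_mul]

/-- At a real point the pseudo-resolvent is the square of the resolvent. -/
theorem pseudoRes_coe {x : ℝ} (hx : (x : ℍ) ∈ resolventSet T) :
    pseudoRes T (x : ℍ) = resolventR T (x : ℍ) * resolventR T (x : ℍ) := by
  -- This says (x - T) R = 1. Since Q_x(T) = (T - x)², two applications give Q_x(T) R² = 1.
  have key : ∀ w, T.Maps ((resolventR T (x : ℍ)).1 w) (x • (resolventR T (x : ℍ)).1 w - w) := by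
    intro w
    have h := ((maps_opRes T (x : ℍ) w).smul x).sub (maps_maps_opRes hx w)
    rw [resolventR_coe]
    simp only [BoundedOp.sub_apply, BoundedOp.smul_apply]
    convert h using 1
    simp only [Quaternion.re_coe, Quaternion.norm_coe, Real.norm_eq_abs, sq_abs]
    module
  refine BoundedOp.ext fun w => ?_
  set R := resolventR T (x : ℍ)
  have h1 := key (R.1 w)
  have h2 := (h1.smul x).sub (key w)
  have h3 := pseudoRes_apply_quad hx h1 h2
  rw [BoundedOp.mul_apply, ← h3]
  congr 1
  simp only [Quaternion.re_coe, Quaternion.norm_coe, Real.norm_eq_abs, sq_abs]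
  module

theorem norm_sub_coe_sq (s : ℍ) (x : ℝ) : ‖s - x‖ ^ 2 = ‖s‖ ^ 2 - 2 * x * s.re + x ^ 2 := by
  rw [sq, sq, ← Quaternion.normSq_eq_norm_mul_self, ← Quaternion.normSq_eq_norm_mul_self,
    Quaternion.normSq_def', Quaternion.normSq_def']
  simp
  ring

theorem abs_re_le_norm (s : ℍ) : |s.re| ≤ ‖s‖ := by
  refine abs_le_of_sq_le_sq ?_ (norm_nonneg _)
  rw [sq ‖s‖, ← Quaternion.normSq_eq_norm_mul_self, Quaternion.normSq_def']
  nlinarith [sq_nonneg s.imI, sq_nonneg s.imJ, sq_nonneg s.imK]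

/-- Points near a real point of the resolvent set. -/
theorem resolvent_bounds_near_real {x m : ℝ} (hx : (x : ℍ) ∈ resolventSet T)
    (hm : ‖resolventR T (x : ℍ)‖ ≤ m) {s : ℍ} (hs : ‖s - x‖ * m ≤ 1 / 4) :
    s ∈ resolventSet T ∧ ‖resolventR T s‖ ≤ 4 * m ∧ ‖resolventL T s‖ ≤ 4 * m := by
  obtain ⟨R, hR⟩ : ∃ R, R = resolventR T (x : ℍ) := ⟨_, rfl⟩
  rw [← hR] at hm
  have hP : pseudoRes T (x : ℍ) = R * R := hR ▸ pseudoRes_coe hx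
  have hK : opRes T (x : ℍ) = x • (R * R) - R := by
    rw [← hP, hR, resolventR_coe]; abel
  have hre : |s.re - x| ≤ ‖s - x‖ := by simpa using abs_re_le_norm (s - x)
  obtain ⟨N, hN1, hN2, hN⟩ := exists_inverse_one_add norm_one_boundedOp_le
    (norm_neumann_perturbation_le hm hre hs)
  -- After inserting P = R² and K = x R² - R, only powers of |s - x| remain: the terms growing with
  -- |x| cancel.
  have hE : (2 * ((x : ℍ).re - s.re)) • opRes T (x : ℍ) +
      (‖s‖ ^ 2 - ‖(x : ℍ)‖ ^ 2) • pseudoRes T (x : ℍ) =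
      (2 * (s.re - x)) • R + ‖s - x‖ ^ 2 • (R * R) := by
    rw [hP, hK, norm_sub_coe_sq]
    simp only [Quaternion.re_coe, Quaternion.norm_coe, Real.norm_eq_abs, sq_abs]
    module
  obtain ⟨h1, h2, h3⟩ := pseudoRes_eq_of_perturbation hx s N
    ((congrArg (fun E => (1 + E) * N) hE).trans hN1) ((congrArg (fun E => N * (1 + E)) hE).trans hN2)
  have hstar : star s = star (s - x) + (x : ℍ) := by simp
  obtain ⟨h4, h5⟩ := norm_neumann_resolvent_le (L := (leftMul (star (s - x)) : BoundedOp V))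
    ((norm_leftMul_le _).trans (norm_star _).le) hm hN hs
  refine ⟨h1, ?_, ?_⟩
  · have : resolventR T s = leftMul (star (s - x)) * (R * R * N) + R * N := by
      rw [resolventR_eq, h2, h3, hP, hK, hstar, leftMul_add, leftMul_coe]
      simp only [add_mul, sub_mul, smul_mul_assoc, one_mul]
      abel
    rw [this]
    exact h4
  · have : resolventL T s = R * R * N * leftMul (star (s - x)) + R * N := by
      rw [resolventL_eq, h2, h3, hP, hK, hstar, leftMul_add, leftMul_coe]
      simp only [mul_add, sub_mul, smul_mul_assoc, mul_smul_comm, mul_one]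
      abel
    rw [this]
    exact h5

theorem re_le_of_le_arg {c : ℝ} (hc : c ∈ Icc (-1 : ℝ) 1) {p : ℍ} (hp : p ≠ 0)
    (h : Real.arccos c ≤ arg p) : p.re ≤ c * ‖p‖ := by
  have hp' : 0 < ‖p‖ := norm_pos_iff.2 hp
  have h1 : p.re / ‖p‖ ∈ Icc (-1 : ℝ) 1 := by
    refine abs_le.1 ?_
    rw [abs_div, abs_norm]
    exact div_le_one_of_le₀ (abs_re_le_norm p) hp'.le
  have := (Real.strictAntiOn_arccos.le_iff_ge hc h1).1 h
  exact (div_le_iff₀ hp').1 this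

/-- The resolvent estimate on the half line extends to a sector. -/
theorem exists_isResolventSector (hT : nonposReals ⊆ resolventSet T) {M : ℝ} (hM : 0 < M)
    (hbound : ∀ s ∈ nonposReals, ‖resolventR T s‖ ≤ M / (1 + ‖s‖)) :
    ∃ a₀ θ₀, IsResolventSector T a₀ θ₀ := by
  -- κ makes every ball of radius κ (1 + |x|) about x ≤ 0 admissible for
  -- `resolvent_bounds_near_real`. Below, k is the slope of the sector, and its vertex a is small
  -- enough for the tip to fit into the ball about 0.
  obtain ⟨κ, hκ⟩ : ∃ κ, κ = 1 / (4 * M) := ⟨_, rfl⟩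
  have hκ0 : 0 < κ := by rw [hκ]; positivity
  have hκM : κ * M = 1 / 4 := by rw [hκ]; field_simp
  obtain ⟨k, hk⟩ : ∃ k, k = min κ 1 := ⟨_, rfl⟩
  have hk0 : 0 < k := by rw [hk]; positivity
  have hkκ : k ≤ κ := by rw [hk]; exact min_le_left _ _
  have hk1 : k ≤ 1 := by rw [hk]; exact min_le_right _ _
  obtain ⟨a, ha⟩ : ∃ a, a = min (κ / 2) 1 := ⟨_, rfl⟩
  have ha0 : 0 < a := by rw [ha]; positivity
  have haκ : 2 * a ≤ κ := by have : a ≤ κ / 2 := by rw [ha]; exact min_le_left _ _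
                             linarith
  have ha1 : a ≤ 1 := by rw [ha]; exact min_le_right _ _
  -- c = cos(arctan k), so the sector of angle arccos(-c) is the cone |Im s| ≤ k (a - Re s).
  obtain ⟨c, hc⟩ : ∃ c, c = (√(1 + k ^ 2))⁻¹ := ⟨_, rfl⟩
  have hc0 : 0 < c := by rw [hc]; positivity
  have hc2 : c ^ 2 * (1 + k ^ 2) = 1 := by
    rw [hc, inv_pow, Real.sq_sqrt (by positivity)]
    exact inv_mul_cancel₀ (by positivity)
  have hc1 : c < 1 := by nlinarith [pow_pos hk0 2, pow_pos hc0 2]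
  have hgeom : ∀ s ∈ closedSector (Real.arccos (-c)) a, ∃ x : ℝ, x ≤ 0 ∧
      ‖s - x‖ ≤ κ * (1 + |x|) := by
    intro s hs
    have hsq := norm_sub_coe_sq s a
    have hsec : s.re - a ≤ -c * ‖s - a‖ := by
      by_cases h0 : s - (a : ℍ) = 0
      · rw [sub_eq_zero] at h0
        simp [h0]
      · rcases hs with hs | hs
        · exact absurd (sub_eq_zero.2 hs) h0
        · simpa using re_le_of_le_arg ⟨by linarith, by linarith⟩ h0 hs
    have hn := norm_nonneg (s - (a : ℍ))
    have hle : s.re ≤ a := by nlinarith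
    have him : ‖s‖ ^ 2 - s.re ^ 2 ≤ k ^ 2 * (s.re - a) ^ 2 := by
      have h1 : c ^ 2 * ‖s - a‖ ^ 2 ≤ (s.re - a) ^ 2 := by nlinarith [mul_nonneg hc0.le hn]
      have h2 : ‖s - a‖ ^ 2 ≤ (1 + k ^ 2) * (s.re - a) ^ 2 := by
        calc ‖s - a‖ ^ 2 = (1 + k ^ 2) * (c ^ 2 * ‖s - a‖ ^ 2) := by
              rw [← mul_assoc, mul_comm (1 + k ^ 2), hc2, one_mul]
          _ ≤ _ := by gcongr
      nlinarith
    -- Left of the imaginary hyperplane the centre is Re s; the tip 0 ≤ Re s ≤ a lies in the ball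
    -- about 0.
    rcases le_total s.re 0 with h | h
    · refine ⟨s.re, h, ?_⟩
      have h1 : ‖s - s.re‖ ≤ k * (a - s.re) := by
        refine (sq_le_sq₀ (norm_nonneg _) (mul_nonneg hk0.le (by linarith))).1 ?_
        rw [norm_sub_coe_sq]
        nlinarith
      rw [abs_of_nonpos h]
      refine h1.trans (mul_le_mul hkκ (by linarith) (by linarith) hκ0.le)
    · refine ⟨0, le_rfl, ?_⟩
      have h1 : ‖s‖ ≤ 2 * a := by
        refine (sq_le_sq₀ (norm_nonneg _) (by linarith)).1 ?_
        have h2 : (s.re - a) ^ 2 ≤ a ^ 2 := by nlinarith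
        have h3 : k ^ 2 ≤ 1 := by nlinarith
        have h4 : k ^ 2 * (s.re - a) ^ 2 ≤ 1 * a ^ 2 := by gcongr
        nlinarith
      simp
      linarith
  -- The constant 4 M + 1 equals 4 M (1 + κ), because 1 + |s| ≤ (1 + κ)(1 + |x|).
  refine ⟨a, Real.arccos (-c), ha0, ⟨?_, ?_⟩, ?_, 4 * M + 1, by positivity, ?_⟩
  · exact Real.arccos_pos.2 (by linarith)
  · exact lt_of_le_of_ne (Real.arccos_le_pi _) fun h => by
      rw [Real.arccos_eq_pi] at h; linarith
  all_goals
    intro s hs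
    obtain ⟨x, hx, hd⟩ := hgeom s hs
    have hxm : (x : ℍ) ∈ nonposReals := ⟨x, hx, rfl⟩
    have hb := hbound _ hxm
    rw [Quaternion.norm_coe, Real.norm_eq_abs] at hb
    have hpos : 0 < 1 + |x| := by positivity
    obtain ⟨h1, h2, h3⟩ := resolvent_bounds_near_real (hT hxm) hb (s := s) (by
      rw [mul_div_assoc', div_le_iff₀ hpos]
      nlinarith)
  · exact h1
  · have hsx : ‖s‖ ≤ |x| + κ * (1 + |x|) := by
      have := norm_add_le (x : ℍ) (s - x)
      rw [add_sub_cancel, Quaternion.norm_coe, Real.norm_eq_abs] at this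
      linarith
    have hfin : 4 * (M / (1 + |x|)) ≤ (4 * M + 1) / (1 + ‖s‖) := by
      rw [mul_div_assoc', div_le_div_iff₀ hpos (by positivity)]
      nlinarith
    exact ⟨h2.trans hfin, h3.trans hfin⟩

end Sector

end QuatFrac
namespace QuatFrac

/-! ### Primitives of vector-valued holomorphic functions -/

section Primitive

variable {E : Type*} [NormedAddCommGroup E] [NormedSpace ℂ E] [CompleteSpace E]

/-- A holomorphic function on an open star-shaped set has a primitive. -/
theorem exists_hasDerivAt_of_starConvex {U : Set ℂ} {a : ℂ} (hU : IsOpen U)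
    (hs : StarConvex ℝ a U) {f : ℂ → E} (hf : DifferentiableOn ℂ f U) :
    ∃ G : ℂ → E, ∀ z ∈ U, HasDerivAt G (f z) z := by
  have hf' : ContinuousOn (deriv f) U := (hf.deriv hU).continuousOn
  have hmem : ∀ z ∈ U, ∀ t ∈ Icc (0 : ℝ) 1, a + t * (z - a) ∈ U := by
    intro z hz t ht
    have := hs.add_smul_sub_mem hz ht.1 ht.2
    simpa using this
  have hfd : ∀ z ∈ U, HasDerivAt f (deriv f z) z := fun z hz =>
    (hf.differentiableAt (hU.mem_nhds hz)).hasDerivAt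
  have hcont : ∀ {h : ℂ → E}, ContinuousOn h U → ∀ z ∈ U,
      ContinuousOn (fun t : ℝ => h (a + t * (z - a))) (uIcc 0 1) := by
    intro h hh z hz
    rw [uIcc_of_le zero_le_one]
    exact hh.comp (by fun_prop) fun t ht => hmem z hz t ht
  refine ⟨fun z => (z - a) • ∫ t in (0 : ℝ)..1, f (a + t * (z - a)), fun z hz => ?_⟩
  obtain ⟨r, hr, hrU⟩ := Metric.nhds_basis_closedBall.mem_iff.1 (hU.mem_nhds hz)
  have hK : IsCompact ((fun p : ℝ × ℂ => a + p.1 * (p.2 - a)) ''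
      (Icc (0 : ℝ) 1 ×ˢ Metric.closedBall z r)) :=
    (isCompact_Icc.prod (isCompact_closedBall z r)).image (by fun_prop)
  obtain ⟨C, hC⟩ := hK.exists_bound_of_continuousOn (f := deriv f) (hf'.mono (by
    rintro _ ⟨⟨t, w⟩, ⟨ht, hw⟩, rfl⟩
    exact hmem w (hrU hw) t ht))
  have hball : Metric.ball z r ∈ 𝓝 z := Metric.ball_mem_nhds z hr
  have key := (intervalIntegral.hasDerivAt_integral_of_dominated_loc_of_deriv_le
    (μ := volume) (a := (0 : ℝ)) (b := 1) (F := fun w (t : ℝ) => f (a + t * (w - a)))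
    (F' := fun w (t : ℝ) => (t : ℂ) • deriv f (a + t * (w - a))) (x₀ := z) (bound := fun _ => C)
    hball ?_ ?_ ?_ ?_ ?_ ?_)
  · have h1 := ((hasDerivAt_id z).sub_const a).smul key.2
    refine h1.congr_deriv ?_
    simp only [id, one_smul]
    -- Differentiating the candidate under the integral gives the integral over [0, 1] of d/dt (t
    -- f(a + t (z - a))), which is f(z).
    have h2 : ∀ t ∈ uIcc (0 : ℝ) 1, HasDerivAt (fun t : ℝ => t • f (a + t * (z - a)))
        (f (a + t * (z - a)) + (z - a) • ((t : ℂ) • deriv f (a + t * (z - a)))) t := by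
      intro t ht
      rw [uIcc_of_le zero_le_one] at ht
      have h3 : HasDerivAt (fun t : ℝ => a + (t : ℂ) * (z - a)) (z - a) t := by
        simpa using ((Complex.ofRealCLM.hasDerivAt (x := t)).mul_const (z - a)).const_add a
      have h4 := (hfd _ (hmem z hz t ht)).scomp t h3
      have h5 := (hasDerivAt_id t).smul h4
      refine h5.congr_deriv ?_
      simp only [id, one_smul, Function.comp, Complex.coe_smul]
      rw [add_comm, smul_comm]
    have h6 := intervalIntegral.integral_eq_sub_of_hasDerivAt h2 ?_
    · rw [intervalIntegral.integral_add, intervalIntegral.integral_smul] at h6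
      · rw [add_comm, h6]
        simp
      · exact (hcont hf.continuousOn z hz).intervalIntegrable
      · refine ContinuousOn.intervalIntegrable ?_
        have := hcont hf' z hz
        fun_prop
    · refine ContinuousOn.intervalIntegrable ?_
      have h7 := hcont hf' z hz
      exact (hcont hf.continuousOn z hz).add (by fun_prop)
  · filter_upwards [hball] with w hw
    refine ((hcont hf.continuousOn w (hrU (Metric.ball_subset_closedBall hw))).mono
      uIoc_subset_uIcc).aestronglyMeasurable measurableSet_uIoc
  · exact (hcont hf.continuousOn z hz).intervalIntegrable
  · refine ContinuousOn.aestronglyMeasurable ?_ measurableSet_uIoc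
    have := (hcont hf' z hz).mono (uIoc_subset_uIcc (a := (0 : ℝ)) (b := 1))
    fun_prop
  · refine Eventually.of_forall fun t ht w hw => ?_
    rw [uIoc_of_le zero_le_one] at ht
    have h1 := hC _ ⟨(t, w), ⟨Ioc_subset_Icc_self ht, Metric.ball_subset_closedBall hw⟩, rfl⟩
    rw [norm_smul, Complex.norm_real, Real.norm_eq_abs, abs_of_pos ht.1]
    have := norm_nonneg (deriv f (a + t * (w - a)))
    nlinarith [ht.2]
  · exact intervalIntegrable_const
  · refine Eventually.of_forall fun t ht w hw => ?_
    rw [uIoc_of_le zero_le_one] at ht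
    have h3 : HasDerivAt (fun w : ℂ => a + (t : ℂ) * (w - a)) t w := by
      simpa using (((hasDerivAt_id w).sub_const a).const_mul (t : ℂ)).const_add a
    exact (hfd _ (hmem w (hrU (Metric.ball_subset_closedBall hw)) t
      (Ioc_subset_Icc_self ht))).scomp w h3

/-- The points that `a` sees inside an open set form an open star-shaped set. -/
theorem exists_isOpen_starConvex {W : Set ℂ} (hW : IsOpen W) (a : ℂ) :
    ∃ U : Set ℂ, IsOpen U ∧ StarConvex ℝ a U ∧ U ⊆ W ∧ ∀ z, segment ℝ a z ⊆ W → z ∈ U := by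
  refine ⟨{z | segment ℝ a z ⊆ W}, ?_, ?_, fun z hz => hz (right_mem_segment ℝ a z),
    fun z hz => hz⟩
  · rw [isOpen_iff_mem_nhds]
    intro z hz
    have h1 : ∀ t ∈ Icc (0 : ℝ) 1, ∀ᶠ p : ℂ × ℝ in 𝓝 (z, t), a + p.2 • (p.1 - a) ∈ W := by
      intro t ht
      have hc : Continuous fun p : ℂ × ℝ => a + p.2 • (p.1 - a) := by fun_prop
      refine hc.continuousAt.eventually (hW.mem_nhds (hz ?_))
      rw [segment_eq_image']
      exact ⟨t, ht, rfl⟩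
    have h2 := isCompact_Icc.eventually_forall_of_forall_eventually
      (P := fun (w : ℂ) (t : ℝ) => a + t • (w - a) ∈ W) h1
    filter_upwards [h2] with w hw
    rw [segment_eq_image']
    rintro _ ⟨t, ht, rfl⟩
    exact hw t ht
  · rw [starConvex_iff_segment_subset]
    intro z hz w hw
    change segment ℝ a w ⊆ W
    exact ((convex_segment a z).segment_subset (left_mem_segment ℝ a z) hw).trans hz

/-- A primitive of a function with decay of order greater than one has a limit at infinity in a
sector. -/
theorem exists_tendsto_primitive_sector {G f : ℂ → E} {a : ℂ} {J : Set ℝ} (hJ : Convex ℝ J)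
    (hJπ : J ⊆ Icc (-Real.pi) Real.pi) (hne : J.Nonempty) {C α R : ℝ} (hα : 0 < α) (hR : 0 < R)
    (hG : ∀ ρ, R ≤ ρ → ∀ φ ∈ J, HasDerivAt G (f (a + ρ * Complex.exp (φ * Complex.I)))
      (a + ρ * Complex.exp (φ * Complex.I)))
    (hf : ∀ ρ, R ≤ ρ → ∀ φ ∈ J, ‖f (a + ρ * Complex.exp (φ * Complex.I))‖ ≤ C * ρ ^ (-1 - α)) :
    ∃ L : E, ∀ (l : Filter ℝ) (ρ φ : ℝ → ℝ), Tendsto ρ l atTop → (∀ᶠ t in l, φ t ∈ J) →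
      Tendsto (fun t => G (a + ρ t * Complex.exp (φ t * Complex.I))) l (𝓝 L) := by
  obtain ⟨φ₀, hφ₀⟩ := hne
  set u : ℝ → E := fun ρ => G (a + ρ * Complex.exp (φ₀ * Complex.I)) with hu
  have hud : ∀ ρ ∈ Ioi R, HasDerivAt u
      (Complex.exp (φ₀ * Complex.I) • f (a + ρ * Complex.exp (φ₀ * Complex.I))) ρ := by
    intro ρ hρ
    have h3 : HasDerivAt (fun t : ℝ => a + (t : ℂ) * Complex.exp (φ₀ * Complex.I))
        (Complex.exp (φ₀ * Complex.I)) ρ := by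
      simpa using ((Complex.ofRealCLM.hasDerivAt (x := ρ)).mul_const
        (Complex.exp (φ₀ * Complex.I))).const_add a
    exact (hG ρ (le_of_lt hρ) φ₀ hφ₀).scomp ρ h3
  -- Along one fixed ray the limit exists because ρ^(-1-α) is integrable at infinity.
  have hu' : Tendsto u atTop (𝓝 (limUnder atTop u)) := by
    refine tendsto_limUnder_of_hasDerivAt_of_integrableOn_Ioi (a := R) hud ?_
    have h1 : IntegrableOn (fun ρ : ℝ => C * ρ ^ (-1 - α)) (Ioi R) :=
      (integrableOn_Ioi_rpow_of_lt (by linarith) hR).const_mul C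
    refine Integrable.mono' h1 ?_ ?_
    · refine (stronglyMeasurable_deriv u).aestronglyMeasurable.congr ?_
      filter_upwards [ae_restrict_mem measurableSet_Ioi] with ρ hρ
      exact (hud ρ hρ).deriv
    · filter_upwards [ae_restrict_mem measurableSet_Ioi] with ρ hρ
      rw [norm_smul, Complex.norm_exp_ofReal_mul_I, one_mul]
      exact hf ρ (le_of_lt hρ) φ₀ hφ₀
  refine ⟨limUnder atTop u, fun l ρ φ hρ hφ => ?_⟩
  -- On an arc of radius ρ the primitive varies by at most 2π ρ · C ρ^(-1-α), which tends to 0; so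
  -- the angle may vary freely in J.
  have hdiff : Tendsto (fun t => G (a + ρ t * Complex.exp (φ t * Complex.I)) - u (ρ t)) l
      (𝓝 0) := by
    have h0 : Tendsto (fun t => C * (ρ t) ^ (-α) * (2 * Real.pi)) l (𝓝 0) := by
      have := (((tendsto_rpow_neg_atTop hα).comp hρ).const_mul C).mul_const (2 * Real.pi)
      simpa using this
    refine squeeze_zero_norm' ?_ h0
    filter_upwards [hφ, hρ.eventually_ge_atTop R] with t ht hRt
    have hpos : 0 < ρ t := hR.trans_le hRt
    have h1 : ∀ ψ ∈ J, HasDerivWithinAt (fun ψ : ℝ => G (a + ρ t * Complex.exp (ψ * Complex.I)))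
        ((ρ t * (Complex.exp (ψ * Complex.I) * Complex.I)) •
          f (a + ρ t * Complex.exp (ψ * Complex.I))) J ψ := by
      intro ψ hψ
      have h3 : HasDerivAt (fun ψ : ℝ => a + ρ t * Complex.exp (ψ * Complex.I))
          (ρ t * (Complex.exp (ψ * Complex.I) * Complex.I)) ψ := by
        have h4 : HasDerivAt (fun ψ : ℝ => (ψ : ℂ) * Complex.I) Complex.I ψ := by
          simpa using (Complex.ofRealCLM.hasDerivAt (x := ψ)).mul_const Complex.I
        exact (h4.cexp.const_mul _).const_add a
      exact ((hG (ρ t) hRt ψ hψ).scomp ψ h3).hasDerivWithinAt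
    have h2 := hJ.norm_image_sub_le_of_norm_hasDerivWithin_le (C := C * (ρ t) ^ (-α)) h1
      (fun ψ hψ => ?_) hφ₀ ht
    · refine h2.trans ?_
      have hC : 0 ≤ C * (ρ t) ^ (-α) := by
        have h5 := (norm_nonneg _).trans (hf (ρ t) hRt φ₀ hφ₀)
        have h6 : 0 < (ρ t) ^ (-1 - α) := Real.rpow_pos_of_pos hpos _
        have h7 : 0 ≤ C := nonneg_of_mul_nonneg_left h5 h6
        positivity
      have h8 := hJπ hφ₀
      have h9 := hJπ ht
      have h10 : ‖φ t - φ₀‖ ≤ 2 * Real.pi := by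
        rw [Real.norm_eq_abs, abs_le]
        constructor <;> linarith [h8.1, h8.2, h9.1, h9.2]
      gcongr
    · rw [norm_smul, norm_mul, norm_mul, Complex.norm_exp_ofReal_mul_I, Complex.norm_I,
        Complex.norm_real, Real.norm_eq_abs, abs_of_pos hpos, mul_one, mul_one]
      calc ρ t * _ ≤ ρ t * (C * (ρ t) ^ (-1 - α)) := by
            gcongr
            exact hf (ρ t) hRt ψ hψ
        _ = C * (ρ t) ^ (-α) := by
            rw [show -1 - α = -α - 1 by ring, Real.rpow_sub_one hpos.ne']
            field_simp
  have := hdiff.add (hu'.comp hρ)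
  simpa using this

end Primitive

/-! ### Fundamental theorem of calculus along piecewise smooth paths -/

section PiecewisePath

variable {E : Type*} [NormedAddCommGroup E] [NormedSpace ℝ E] [CompleteSpace E]

/-- The fundamental theorem of calculus for functions that are piecewise `C¹`, in a local form. -/
theorem integral_eq_sub_of_local {H h : ℝ → E}
    (hloc : ∀ t, ∃ ε > 0, ∀ u v, (t - ε ≤ u ∧ v = t ∨ u = t ∧ v ≤ t + ε) → u ≤ v →
      IntervalIntegrable h volume u v ∧ ∫ x in u..v, h x = H v - H u) (b c : ℝ) :
    IntervalIntegrable h volume b c ∧ ∫ x in b..c, h x = H c - H b := by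
  have hint : ∀ b c, IntervalIntegrable h volume b c := by
    have : LocallyIntegrable h volume := by
      intro t
      obtain ⟨ε, hε, h1⟩ := hloc t
      have h2 := (h1 (t - ε) t (Or.inl ⟨le_rfl, rfl⟩) (by linarith)).1
      have h3 := (h1 t (t + ε) (Or.inr ⟨rfl, le_rfl⟩) (by linarith)).1
      refine ⟨Ioc (t - ε) (t + ε), Ioc_mem_nhds (by linarith) (by linarith), ?_⟩
      exact (intervalIntegrable_iff_integrableOn_Ioc_of_le (by linarith)).1 (h2.trans h3)
    exact fun b c => (this.integrableOn_isCompact isCompact_uIcc).intervalIntegrable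
  refine ⟨hint b c, ?_⟩
  -- The difference of the integral and H is locally constant, hence constant on the connected line;
  -- no partition has to be chosen.
  have hlc : IsLocallyConstant fun u => (∫ x in b..u, h x) - H u := by
    rw [IsLocallyConstant.iff_eventually_eq]
    intro t
    obtain ⟨ε, hε, h1⟩ := hloc t
    filter_upwards [Ioo_mem_nhds (show t - ε < t by linarith) (show t < t + ε by linarith)]
      with u hu
    rcases le_total u t with hut | hut
    · have h2 := (h1 u t (Or.inl ⟨hu.1.le, rfl⟩) hut).2
      have h3 := intervalIntegral.integral_add_adjacent_intervals (hint b u) (hint u t)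
      rw [← h3, h2]; abel
    · have h2 := (h1 t u (Or.inr ⟨rfl, hu.2.le⟩) hut).2
      have h3 := intervalIntegral.integral_add_adjacent_intervals (hint b t) (hint t u)
      rw [← h3, h2]; abel
  have := hlc.apply_eq_of_preconnectedSpace c b
  simp only [intervalIntegral.integral_same, zero_sub] at this
  rw [sub_eq_iff_eq_add] at this
  rw [this]; abel

variable [NormedSpace ℂ E] [IsScalarTower ℝ ℂ E]

theorem integral_smul_deriv_of_contDiffOn {g : ℝ → ℂ} {G f : ℂ → E} {u v : ℝ} (huv : u ≤ v)
    (hg : ContDiffOn ℝ 1 g (Icc u v)) (hG : ∀ t, HasDerivAt G (f (g t)) (g t))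
    (hf : ContinuousOn (fun t => f (g t)) (Icc u v)) :
    IntervalIntegrable (fun t => deriv g t • f (g t)) volume u v ∧
      ∫ t in u..v, deriv g t • f (g t) = G (g v) - G (g u) := by
  rcases huv.eq_or_lt with rfl | huv'
  · simp
  have hsm : Continuous fun p : ℂ × E => p.1 • p.2 := continuous_smul
  have hint : IntervalIntegrable (fun t => deriv g t • f (g t)) volume u v := by
    have h1 : ContinuousOn (fun t => derivWithin g (Icc u v) t • f (g t)) (Icc u v) :=
      hsm.comp_continuousOn
        ((hg.continuousOn_derivWithin (uniqueDiffOn_Icc huv') le_rfl).prodMk hf)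
    have h2 : IntervalIntegrable (fun t => derivWithin g (Icc u v) t • f (g t)) volume u v :=
      h1.intervalIntegrable_of_Icc huv
    refine h2.congr_ae ?_
    rw [uIoc_of_le huv]
    -- At a corner `deriv g` need not be the one-sided derivative, but the end point is a null set.
    have : ∀ᵐ x : ℝ, x ≠ v := by simp [ae_iff]
    filter_upwards [ae_restrict_mem measurableSet_Ioc, ae_restrict_of_ae this] with t ht htv
    rw [derivWithin_of_mem_nhds (Icc_mem_nhds ht.1 (lt_of_le_of_ne ht.2 htv))]
  refine ⟨hint, ?_⟩
  refine intervalIntegral.integral_eq_sub_of_hasDerivAt_of_le huv (f := fun t => G (g t)) ?_ ?_ hint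
  · intro t ht
    exact (hG t).continuousAt.comp_continuousWithinAt (hg.continuousOn t ht)
  · intro t ht
    have hn : Icc u v ∈ 𝓝 t := Icc_mem_nhds ht.1 ht.2
    have hd : HasDerivAt g (deriv g t) t :=
      ((hg.contDiffAt hn).differentiableAt one_ne_zero).hasDerivAt
    exact (hG t).scomp t hd

/-- The fundamental theorem of calculus along a piecewise `C¹` path in the complex plane. -/
theorem integral_smul_deriv_of_piecewise {g : ℝ → ℂ} {G f : ℂ → E}
    (hg : ∀ t : ℝ, ∃ ε : ℝ, 0 < ε ∧ ContDiffOn ℝ 1 g (Icc (t - ε) t) ∧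
      ContDiffOn ℝ 1 g (Icc t (t + ε)))
    (hG : ∀ t, HasDerivAt G (f (g t)) (g t)) (hf : ∀ t, ContinuousAt f (g t)) (b c : ℝ) :
    IntervalIntegrable (fun t => deriv g t • f (g t)) volume b c ∧
      ∫ t in b..c, deriv g t • f (g t) = G (g c) - G (g b) := by
  refine integral_eq_sub_of_local (H := fun t => G (g t)) (fun t => ?_) b c
  obtain ⟨ε, hε, h1, h2⟩ := hg t
  have key : ∀ u v, u ≤ v → ContDiffOn ℝ 1 g (Icc u v) →
      IntervalIntegrable (fun t => deriv g t • f (g t)) volume u v ∧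
      ∫ t in u..v, deriv g t • f (g t) = G (g v) - G (g u) := fun u v huv h =>
    integral_smul_deriv_of_contDiffOn huv h hG fun t ht =>
      (hf t).comp_continuousWithinAt (h.continuousOn t ht)
  refine ⟨ε, hε, ?_⟩
  rintro u v (⟨hu, rfl⟩ | ⟨rfl, hv⟩) huv
  · exact key u v huv (h1.mono (Icc_subset_Icc hu le_rfl))
  · exact key u v huv (h2.mono (Icc_subset_Icc le_rfl hv))

end PiecewisePath

end QuatFrac
namespace QuatFrac

/-! ### Path independence in a slit sector -/

section PlaneSector

/-- The part of the closed sector with vertex `a` and angle `θ` that is off the negative half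
line. -/
def slitSector (θ a : ℝ) : Set ℂ :=
  {z | z ∈ Complex.slitPlane ∧ (z - a).re ≤ Real.cos θ * ‖z - a‖}

/-- The slit does not spoil star-shapedness about a > 0: on the segment away from a, a nonzero
imaginary part stays nonzero and a positive real part stays positive. -/
theorem segment_subset_slitSector {θ a : ℝ} (ha : 0 < a) {z : ℂ} (hz : z ∈ slitSector θ a) :
    segment ℝ (a : ℂ) z ⊆ slitSector θ a := by
  rw [segment_eq_image']
  rintro _ ⟨t, ht, rfl⟩
  obtain ⟨hz1, hz2⟩ := hz
  refine ⟨?_, ?_⟩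
  · rw [Complex.mem_slitPlane_iff] at hz1 ⊢
    simp only [Complex.add_re, Complex.ofReal_re, Complex.real_smul, Complex.re_ofReal_mul,
      Complex.sub_re, Complex.add_im, Complex.ofReal_im, Complex.im_ofReal_mul, Complex.sub_im,
      sub_zero, zero_add]
    by_cases h0 : t = 0
    · left; simpa [h0] using ha
    · have ht0 : 0 < t := lt_of_le_of_ne ht.1 (Ne.symm h0)
      rcases hz1 with h | h
      · left
        nlinarith [mul_pos ht0 h, mul_nonneg (sub_nonneg.2 ht.2) ha.le]
      · right
        exact mul_ne_zero h0 h
  · rw [add_sub_cancel_left, Complex.real_smul, Complex.re_ofReal_mul, norm_mul,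
      Complex.norm_real, Real.norm_eq_abs, abs_of_nonneg ht.1]
    nlinarith [mul_le_mul_of_nonneg_left hz2 ht.1]

theorem polar_mem_slitSector {θ a ρ φ : ℝ} (hθ : θ ∈ Ioo 0 Real.pi) (hρ : 0 < ρ)
    (h : φ ∈ Ico θ Real.pi ∨ φ ∈ Ioc (-Real.pi) (-θ)) :
    (a : ℂ) + ρ * Complex.exp (φ * Complex.I) ∈ slitSector θ a := by
  have hsin : Real.sin φ ≠ 0 := by
    rcases h with h | h
    · exact (Real.sin_pos_of_pos_of_lt_pi (hθ.1.trans_le h.1) h.2).ne'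
    · exact (Real.sin_neg_of_neg_of_neg_pi_lt (by linarith [hθ.1, h.2]) h.1).ne
  have hcos : Real.cos φ ≤ Real.cos θ := by
    rcases h with h | h
    · exact Real.cos_le_cos_of_nonneg_of_le_pi hθ.1.le h.2.le h.1
    · rw [← Real.cos_neg φ]
      exact Real.cos_le_cos_of_nonneg_of_le_pi hθ.1.le (by linarith [h.1]) (by linarith [h.2])
  refine ⟨?_, ?_⟩
  · rw [Complex.mem_slitPlane_iff]
    right
    simpa [Complex.exp_ofReal_mul_I_im, Complex.exp_ofReal_mul_I_re] using ⟨hρ.ne', hsin⟩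
  · rw [add_sub_cancel_left, Complex.re_ofReal_mul, Complex.exp_ofReal_mul_I_re, norm_mul,
      Complex.norm_exp_ofReal_mul_I, Complex.norm_real, Real.norm_eq_abs, abs_of_pos hρ, mul_one,
      mul_comm]
    gcongr

theorem arg_sub_mem_of_mem_slitSector {θ a : ℝ} (hθ : θ ∈ Ioo 0 Real.pi) {z : ℂ}
    (hz : z ∈ slitSector θ a) :
    (0 < z.im → (z - a).arg ∈ Ico θ Real.pi) ∧ (z.im < 0 → (z - a).arg ∈ Ioc (-Real.pi) (-θ)) := by
  have him : (z - a).im = z.im := by simp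
  have hcos : z.im ≠ 0 → Real.cos (z - a).arg ≤ Real.cos θ := by
    intro h
    have h0 : z - a ≠ 0 := fun h0 => h (by rw [← him, h0]; simp)
    rw [Complex.cos_arg h0]
    exact (div_le_iff₀ (norm_pos_iff.2 h0)).2 hz.2
  refine ⟨fun h => ?_, fun h => ?_⟩
  · have h1 : 0 ≤ (z - a).arg := Complex.arg_nonneg_iff.2 (by rw [him]; exact h.le)
    have h2 : (z - a).arg < Real.pi := Complex.arg_lt_pi_iff.2 (Or.inr (by rw [him]; exact h.ne'))
    exact ⟨(Real.strictAntiOn_cos.le_iff_ge ⟨h1, h2.le⟩ ⟨hθ.1.le, hθ.2.le⟩).1 (hcos h.ne'), h2⟩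
  · have h1 : (z - a).arg < 0 := Complex.arg_neg_iff.2 (by rw [him]; exact h)
    have h2 := Complex.neg_pi_lt_arg (z - a)
    have h3 := hcos h.ne
    rw [← Real.cos_neg] at h3
    have := (Real.strictAntiOn_cos.le_iff_ge ⟨by linarith, by linarith⟩ ⟨hθ.1.le, hθ.2.le⟩).1 h3
    exact ⟨h2, by linarith⟩

/-- A piecewise `C¹` path in a slit sector that comes from infinity in the upper half plane and
goes to infinity in the lower half plane. -/
structure IsSectorPath (θ a : ℝ) (g : ℝ → ℂ) : Prop where
  piecewise : ∀ t : ℝ, ∃ ε : ℝ, 0 < ε ∧ ContDiffOn ℝ 1 g (Icc (t - ε) t) ∧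
    ContDiffOn ℝ 1 g (Icc t (t + ε))
  mem : ∀ t, g t ∈ slitSector θ a
  tendsto_atBot : Tendsto (fun t => ‖g t‖) atBot atTop
  tendsto_atTop : Tendsto (fun t => ‖g t‖) atTop atTop
  im_pos : ∀ᶠ t in atBot, 0 < (g t).im
  im_neg : ∀ᶠ t in atTop, (g t).im < 0

variable {E : Type*} [NormedAddCommGroup E] [NormedSpace ℝ E] [CompleteSpace E]
  [NormedSpace ℂ E] [IsScalarTower ℝ ℂ E]

/-- The integral of a holomorphic function with decay of order greater than one is the same for
all paths in a slit sector. -/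
theorem exists_tendsto_integral_sectorPath {θ a : ℝ} (ha : 0 < a) (hθ : θ ∈ Ioo 0 Real.pi)
    {W : Set ℂ} (hW : IsOpen W) (hsub : slitSector θ a ⊆ W) {f : ℂ → E}
    (hf : DifferentiableOn ℂ f W) {C α : ℝ} (hC : 0 ≤ C) (hα : 0 < α)
    (hb : ∀ z ∈ slitSector θ a, ‖f z‖ ≤ C * ‖z‖ ^ (-1 - α)) :
    ∃ L : E, ∀ g, IsSectorPath θ a g →
      (∀ b c, IntervalIntegrable (fun t => deriv g t • f (g t)) volume b c) ∧
      Tendsto (fun p : ℝ × ℝ => ∫ t in p.1..p.2, deriv g t • f (g t)) (atBot ×ˢ atTop)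
        (𝓝 L) := by
  -- The slit sector is not open, so the primitive is built on the open set of points of W visible
  -- from a, which contains it.
  obtain ⟨U, hU, hUs, hUW, hUm⟩ := exists_isOpen_starConvex hW (a : ℂ)
  have hDU : slitSector θ a ⊆ U := fun z hz =>
    hUm z ((segment_subset_slitSector ha hz).trans hsub)
  obtain ⟨G, hG⟩ := exists_hasDerivAt_of_starConvex hU hUs (hf.mono hUW)
  -- |z - a| = ρ ≥ 2a forces |z| ≥ ρ/2, whence the factor 2^(1+α).
  have hdecay : ∀ ρ, 2 * a ≤ ρ → ∀ z : ℂ, ‖z - a‖ = ρ → z ∈ slitSector θ a →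
      ‖f z‖ ≤ C * 2 ^ (1 + α) * ρ ^ (-1 - α) := by
    intro ρ hρ z hz hzD
    have hρ0 : 0 < ρ := by linarith
    have h1 : ρ / 2 ≤ ‖z‖ := by
      have := norm_sub_le z (a : ℂ)
      rw [hz, Complex.norm_real, Real.norm_eq_abs, abs_of_pos ha] at this
      linarith
    calc ‖f z‖ ≤ C * ‖z‖ ^ (-1 - α) := hb z hzD
      _ ≤ C * (ρ / 2) ^ (-1 - α) :=
        mul_le_mul_of_nonneg_left
          (Real.rpow_le_rpow_of_nonpos (by linarith) h1 (by linarith)) hC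
      _ = C * 2 ^ (1 + α) * ρ ^ (-1 - α) := by
        rw [Real.div_rpow hρ0.le zero_le_two, show (1 + α) = -(-1 - α) by ring,
          Real.rpow_neg zero_le_two]
        ring
  have hnorm : ∀ ρ φ : ℝ, 2 * a ≤ ρ →
      ‖(a : ℂ) + ρ * Complex.exp (φ * Complex.I) - a‖ = ρ := by
    intro ρ φ hρ
    rw [add_sub_cancel_left, norm_mul, Complex.norm_exp_ofReal_mul_I, Complex.norm_real,
      Real.norm_eq_abs, abs_of_pos (by linarith), mul_one]
  -- Far from the vertex the slit separates the upper from the lower part of the sector, so each has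
  -- its own limit.
  obtain ⟨L₁, hL₁⟩ := exists_tendsto_primitive_sector (G := G) (f := f) (a := a)
    (J := Ico θ Real.pi) (convex_Ico _ _) (fun x hx => ⟨by linarith [hθ.1, hx.1, Real.pi_pos], hx.2.le⟩)
    ⟨θ, le_rfl, hθ.2⟩ hα (show 0 < 2 * a by linarith)
    (fun ρ hρ φ hφ => hG _ (hDU (polar_mem_slitSector hθ (by linarith) (Or.inl hφ))))
    (fun ρ hρ φ hφ => hdecay ρ hρ _ (hnorm ρ φ hρ)
      (polar_mem_slitSector hθ (by linarith) (Or.inl hφ)))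
  obtain ⟨L₂, hL₂⟩ := exists_tendsto_primitive_sector (G := G) (f := f) (a := a)
    (J := Ioc (-Real.pi) (-θ)) (convex_Ioc _ _)
    (fun x hx => ⟨hx.1.le, by linarith [hθ.1, hx.2, Real.pi_pos]⟩)
    ⟨-θ, by linarith [hθ.2], le_rfl⟩ hα (show 0 < 2 * a by linarith)
    (fun ρ hρ φ hφ => hG _ (hDU (polar_mem_slitSector hθ (by linarith) (Or.inr hφ))))
    (fun ρ hρ φ hφ => hdecay ρ hρ _ (hnorm ρ φ hρ)
      (polar_mem_slitSector hθ (by linarith) (Or.inr hφ)))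
  refine ⟨L₂ - L₁, fun g hg => ?_⟩
  have hftc := integral_smul_deriv_of_piecewise hg.piecewise (G := G) (f := f)
    (fun t => hG _ (hDU (hg.mem t)))
    (fun t => (hf.differentiableAt (hW.mem_nhds (hsub (hg.mem t)))).continuousAt)
  refine ⟨fun b c => (hftc b c).1, ?_⟩
  have hpolar : ∀ t, (a : ℂ) + ‖g t - a‖ * Complex.exp ((g t - a).arg * Complex.I) = g t :=
    fun t => by rw [Complex.norm_mul_exp_arg_mul_I]; ring
  have hinf : ∀ l : Filter ℝ, Tendsto (fun t => ‖g t‖) l atTop →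
      Tendsto (fun t => ‖g t - a‖) l atTop := by
    intro l hl
    refine tendsto_atTop_mono (fun t => ?_) (tendsto_atTop_add_const_right l (-‖(a : ℂ)‖) hl)
    have := norm_sub_norm_le (g t) (a : ℂ)
    linarith
  have h1 : Tendsto (fun t => G (g t)) atBot (𝓝 L₁) := by
    have := hL₁ atBot (fun t => ‖g t - a‖) (fun t => (g t - a).arg) (hinf _ hg.tendsto_atBot)
      (hg.im_pos.mono fun t ht => (arg_sub_mem_of_mem_slitSector hθ (hg.mem t)).1 ht)
    simpa only [hpolar] using this
  have h2 : Tendsto (fun t => G (g t)) atTop (𝓝 L₂) := by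
    have := hL₂ atTop (fun t => ‖g t - a‖) (fun t => (g t - a).arg) (hinf _ hg.tendsto_atTop)
      (hg.im_neg.mono fun t ht => (arg_sub_mem_of_mem_slitSector hθ (hg.mem t)).2 ht)
    simpa only [hpolar] using this
  have h3 := (h2.comp (tendsto_snd (f := (atBot : Filter ℝ)))).sub (h1.comp tendsto_fst)
  refine h3.congr fun p => ?_
  exact ((hftc p.1 p.2).2).symm

end PlaneSector

/-! ### Holomorphy of the S-resolvents on a slice -/

section SlicePair

variable {A : Type*} [NormedRing A] [NormedAlgebra ℝ A]

/-- Two families `P`, `K` in a Banach algebra that behave like `(T² - 2 Re(z) T + |z|²)⁻¹` and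
`T (T² - 2 Re(z) T + |z|²)⁻¹`. -/
structure IsSlicePair (W : Set ℂ) (P K : ℂ → A) : Prop where
  isOpen : IsOpen W
  continuousAt_fst : ∀ z ∈ W, ContinuousAt P z
  continuousAt_snd : ∀ z ∈ W, ContinuousAt K z
  comm : ∀ w ∈ W, ∀ z ∈ W, P w * K z = K w * P z
  mul : ∀ w ∈ W, ∀ z ∈ W,
    K w * K z = P w + (2 * z.re) • (P w * K z) - (‖z‖ ^ 2) • (P w * P z)
  sub_fst : ∀ w ∈ W, ∀ z ∈ W,
    P w - P z = (2 * (w.re - z.re)) • (P w * K z) - (‖w‖ ^ 2 - ‖z‖ ^ 2) • (P w * P z)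
  sub_snd : ∀ w ∈ W, ∀ z ∈ W,
    K w - K z = (2 * (w.re - z.re)) • (K w * K z) - (‖w‖ ^ 2 - ‖z‖ ^ 2) • (P w * K z)

/-- Real and imaginary parts of R(w) - R(z) = (z - w) R(w) R(z) for R(z) = (x P - K) - i (y P), with
i a formal commuting unit. In this form no actual imaginary unit has to commute with P or K. -/
theorem IsSlicePair.resolvent_identity {W : Set ℂ} {P K : ℂ → A} (h : IsSlicePair W P K)
    {w z : ℂ} (hw : w ∈ W) (hz : z ∈ W) :
    ((w.re • P w - K w) - (z.re • P z - K z) =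
      (z.re - w.re) • ((w.re • P w - K w) * (z.re • P z - K z) - (w.im • P w) * (z.im • P z)) +
      (z.im - w.im) • ((w.re • P w - K w) * (z.im • P z) + (w.im • P w) * (z.re • P z - K z))) ∧
    (z.im • P z - w.im • P w =
      (z.im - w.im) • ((w.re • P w - K w) * (z.re • P z - K z) - (w.im • P w) * (z.im • P z)) -
      (z.re - w.re) • ((w.re • P w - K w) * (z.im • P z) + (w.im • P w) * (z.re • P z - K z))) := by
  have h1 := h.comm w hw z hz
  have h2 := h.mul w hw z hz
  have h3 := h.sub_fst w hw z hz
  have h4 := h.sub_snd w hw z hz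
  have hn : ∀ z : ℂ, ‖z‖ ^ 2 = z.re ^ 2 + z.im ^ 2 := fun z => by
    rw [Complex.sq_norm, Complex.normSq_apply]; ring
  rw [hn] at h2
  rw [hn, hn] at h3 h4
  simp only [sub_mul, mul_sub, smul_mul_assoc, mul_smul_comm]
  rw [← h1]
  constructor
  · linear_combination (norm := module) z.re • h3 - h4 - (w.re - z.re) • h2
  · linear_combination (norm := module) -z.im • h3 + (w.im - z.im) • h2

/-- The derivative is -B z; continuity of B at z suffices. -/
theorem differentiableAt_of_sub_eq_smul {E : Type*} [NormedAddCommGroup E] [NormedSpace ℂ E]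
    {F B : ℂ → E} {z : ℂ} (hB : ContinuousAt B z)
    (h : ∀ᶠ w in 𝓝 z, F w - F z = (z - w) • B w) : DifferentiableAt ℂ F z := by
  refine HasDerivAt.differentiableAt (f' := -B z) (hasDerivAt_iff_tendsto_slope.2 ?_)
  refine (hB.neg.tendsto.mono_left nhdsWithin_le_nhds).congr' ?_
  filter_upwards [self_mem_nhdsWithin, mem_nhdsWithin_of_mem_nhds h] with w hw hwW
  have hne : w - z ≠ 0 := sub_ne_zero.2 hw
  rw [slope_def_module, hwW, ← neg_sub w z, neg_smul, smul_neg, smul_smul,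
    inv_mul_cancel₀ hne, one_smul, Pi.neg_apply]

theorem algHom_complex_apply (φ : ℂ →ₐ[ℝ] A) (c : ℂ) :
    φ c = c.re • (1 : A) + c.im • φ Complex.I := by
  conv_lhs => rw [← Complex.re_add_im c]
  rw [map_add, map_mul]
  have h : ∀ r : ℝ, φ (r : ℂ) = r • (1 : A) := fun r => by
    rw [← Algebra.algebraMap_eq_smul_one]; exact φ.commutes r
  rw [h, h, smul_mul_assoc, one_mul]

theorem algHom_I_mul_I (φ : ℂ →ₐ[ℝ] A) : φ Complex.I * φ Complex.I = -1 := by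
  rw [← map_mul, Complex.I_mul_I, map_neg, map_one]

theorem IsSlicePair.continuousAt_re {W : Set ℂ} {P K : ℂ → A} (h : IsSlicePair W P K) {z : ℂ}
    (hz : z ∈ W) : ContinuousAt (fun w => w.re • P w - K w) z :=
  (Complex.continuous_re.continuousAt.smul (h.continuousAt_fst z hz)).sub (h.continuousAt_snd z hz)

theorem IsSlicePair.continuousAt_im {W : Set ℂ} {P K : ℂ → A} (h : IsSlicePair W P K) {z : ℂ}
    (hz : z ∈ W) : ContinuousAt (fun w => w.im • P w) z :=
  Complex.continuous_im.continuousAt.smul (h.continuousAt_fst z hz)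

/-- The right slice resolvent. -/
noncomputable def sliceRight (φ : ℂ →ₐ[ℝ] A) (P K : ℂ → A) (z : ℂ) : A :=
  φ ((starRingEnd ℂ) z) * P z - K z

/-- The left slice resolvent. -/
noncomputable def sliceLeft (φ : ℂ →ₐ[ℝ] A) (P K : ℂ → A) (z : ℂ) : A :=
  P z * φ ((starRingEnd ℂ) z) - K z

theorem sliceRight_eq (φ : ℂ →ₐ[ℝ] A) (P K : ℂ → A) (z : ℂ) :
    sliceRight φ P K z = (z.re • P z - K z) - φ Complex.I * (z.im • P z) := by
  rw [sliceRight, algHom_complex_apply]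
  simp only [Complex.conj_re, Complex.conj_im, add_mul, smul_mul_assoc, one_mul, mul_smul_comm]
  module

theorem sliceLeft_eq (φ : ℂ →ₐ[ℝ] A) (P K : ℂ → A) (z : ℂ) :
    sliceLeft φ P K z = (z.re • P z - K z) - (z.im • P z) * φ Complex.I := by
  rw [sliceLeft, algHom_complex_apply]
  simp only [Complex.conj_re, Complex.conj_im, mul_add, smul_mul_assoc, mul_one, mul_smul_comm]
  module

/-- The complex structure on a real Banach algebra given by left multiplication. -/
@[reducible] noncomputable def leftComplexStructure (φ : ℂ →ₐ[ℝ] A) (hφ : ∀ c, ‖φ c‖ ≤ ‖c‖) : NormedSpace ℂ A where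
  smul c x := φ c * x
  one_smul x := by change φ 1 * x = x; simp
  mul_smul c d x := by change φ (c * d) * x = φ c * (φ d * x); rw [map_mul, mul_assoc]
  smul_zero c := mul_zero _
  smul_add c x y := mul_add _ _ _
  add_smul c d x := by change φ (c + d) * x = φ c * x + φ d * x; rw [map_add, add_mul]
  zero_smul x := by change φ 0 * x = 0; simp
  norm_smul_le c x := (norm_mul_le _ _).trans (mul_le_mul_of_nonneg_right (hφ c) (norm_nonneg x))

/-- The complex structure on a real Banach algebra given by right multiplication. -/
@[reducible] noncomputable def rightComplexStructure (φ : ℂ →ₐ[ℝ] A) (hφ : ∀ c, ‖φ c‖ ≤ ‖c‖) : NormedSpace ℂ A where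
  smul c x := x * φ c
  one_smul x := by change x * φ 1 = x; simp
  mul_smul c d x := by
    change x * φ (c * d) = x * φ d * φ c; rw [mul_comm c d, map_mul, mul_assoc]
  smul_zero c := zero_mul _
  smul_add c x y := add_mul _ _ _
  add_smul c d x := by change x * φ (c + d) = x * φ c + x * φ d; rw [map_add, mul_add]
  zero_smul x := by change x * φ 0 = 0; simp
  norm_smul_le c x := (norm_mul_le _ _).trans (by
    rw [mul_comm]; exact mul_le_mul_of_nonneg_right (hφ c) (norm_nonneg x))

/-- φ(i) occurs only as a left factor, so the two real identities recombine into an increment φ(z -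
w) (X - φ(i) Y), a scalar multiple for the left complex structure. -/
theorem IsSlicePair.differentiableOn_sliceRight {W : Set ℂ} {P K : ℂ → A}
    (h : IsSlicePair W P K) (φ : ℂ →ₐ[ℝ] A) (hφ : ∀ c, ‖φ c‖ ≤ ‖c‖) :
    letI := leftComplexStructure φ hφ
    DifferentiableOn ℂ (sliceRight φ P K) W := by
  intro z hz
  have hc1 := h.continuousAt_re hz
  have hc2 := h.continuousAt_im hz
  have hB : ContinuousAt (fun w =>
      ((w.re • P w - K w) * (z.re • P z - K z) - (w.im • P w) * (z.im • P z)) -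
      φ Complex.I * ((w.re • P w - K w) * (z.im • P z) + (w.im • P w) * (z.re • P z - K z))) z :=
    ((hc1.mul_const _).sub (hc2.mul_const _)).sub
      (((hc1.mul_const _).add (hc2.mul_const _)).const_mul _)
  have key : ∀ᶠ w in 𝓝 z, sliceRight φ P K w - sliceRight φ P K z = φ (z - w) *
      (((w.re • P w - K w) * (z.re • P z - K z) - (w.im • P w) * (z.im • P z)) -
      φ Complex.I * ((w.re • P w - K w) * (z.im • P z) + (w.im • P w) * (z.re • P z - K z))) := by
    filter_upwards [h.isOpen.mem_nhds hz] with w hw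
    obtain ⟨h1, h2⟩ := h.resolvent_identity hw hz
    rw [sliceRight_eq, sliceRight_eq, sub_sub_sub_comm, h1, ← mul_sub, ← neg_sub (z.im • P z), h2,
      algHom_complex_apply φ (z - w)]
    generalize (w.re • P w - K w) * (z.re • P z - K z) - (w.im • P w) * (z.im • P z) = X
    generalize (w.re • P w - K w) * (z.im • P z) + (w.im • P w) * (z.re • P z - K z) = Y
    have hY : φ Complex.I * (φ Complex.I * Y) = -Y := by
      rw [← mul_assoc, algHom_I_mul_I, neg_mul, one_mul]
    simp only [add_mul, mul_sub, mul_smul_comm, one_mul, hY, mul_neg, smul_mul_assoc,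
      Complex.sub_re, Complex.sub_im]
    module
  let _ := leftComplexStructure φ hφ
  exact (differentiableAt_of_sub_eq_smul hB key).differentiableWithinAt

theorem IsSlicePair.differentiableOn_sliceLeft {W : Set ℂ} {P K : ℂ → A}
    (h : IsSlicePair W P K) (φ : ℂ →ₐ[ℝ] A) (hφ : ∀ c, ‖φ c‖ ≤ ‖c‖) :
    letI := rightComplexStructure φ hφ
    DifferentiableOn ℂ (sliceLeft φ P K) W := by
  intro z hz
  have hc1 := h.continuousAt_re hz
  have hc2 := h.continuousAt_im hz
  have hB : ContinuousAt (fun w =>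
      ((w.re • P w - K w) * (z.re • P z - K z) - (w.im • P w) * (z.im • P z)) -
      ((w.re • P w - K w) * (z.im • P z) + (w.im • P w) * (z.re • P z - K z)) * φ Complex.I) z :=
    ((hc1.mul_const _).sub (hc2.mul_const _)).sub
      (((hc1.mul_const _).add (hc2.mul_const _)).mul_const _)
  have key : ∀ᶠ w in 𝓝 z, sliceLeft φ P K w - sliceLeft φ P K z =
      (((w.re • P w - K w) * (z.re • P z - K z) - (w.im • P w) * (z.im • P z)) -
      ((w.re • P w - K w) * (z.im • P z) + (w.im • P w) * (z.re • P z - K z)) * φ Complex.I) *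
      φ (z - w) := by
    filter_upwards [h.isOpen.mem_nhds hz] with w hw
    obtain ⟨h1, h2⟩ := h.resolvent_identity hw hz
    rw [sliceLeft_eq, sliceLeft_eq, sub_sub_sub_comm, h1, ← sub_mul, ← neg_sub (z.im • P z), h2,
      algHom_complex_apply φ (z - w)]
    generalize (w.re • P w - K w) * (z.re • P z - K z) - (w.im • P w) * (z.im • P z) = X
    generalize (w.re • P w - K w) * (z.im • P z) + (w.im • P w) * (z.re • P z - K z) = Y
    have hY : Y * φ Complex.I * φ Complex.I = -Y := by
      rw [mul_assoc, algHom_I_mul_I, mul_neg, mul_one]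
    simp only [mul_add, sub_mul, mul_smul_comm, mul_one, hY, neg_mul, smul_mul_assoc,
      Complex.sub_re, Complex.sub_im]
    module
  let _ := rightComplexStructure φ hφ
  exact (differentiableAt_of_sub_eq_smul hB key).differentiableWithinAt

end SlicePair

end QuatFrac
namespace QuatFrac

/-! ### Convergence of the slice integrals -/

section SliceIntegral

variable {A : Type*} [NormedRing A] [NormedAlgebra ℝ A]

/-- The integrand `z^{-α} (-i dz) S_R⁻¹(z)` along a path. -/
noncomputable def rightForm (φ : ℂ →ₐ[ℝ] A) (P K : ℂ → A) (α : ℝ) (g : ℝ → ℂ) (t : ℝ) : A :=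
  φ (g t ^ ((-α : ℝ) : ℂ)) * φ (-Complex.I * deriv g t) * sliceRight φ P K (g t)

/-- The integrand `S_L⁻¹(z) (-i dz) z^{-α}` along a path. -/
noncomputable def leftForm (φ : ℂ →ₐ[ℝ] A) (P K : ℂ → A) (α : ℝ) (g : ℝ → ℂ) (t : ℝ) : A :=
  sliceLeft φ P K (g t) * φ (-Complex.I * deriv g t) * φ (g t ^ ((-α : ℝ) : ℂ))

theorem differentiableAt_neg_I_mul_cpow {z : ℂ} (hz : z ∈ Complex.slitPlane) (c : ℂ) :
    DifferentiableAt ℂ (fun z : ℂ => -Complex.I * z ^ c) z :=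
  (differentiableAt_id.cpow_const hz).const_mul _

/-- The power contributes order -α, exactly since the exponent is real, and the resolvent order -1.
-/
theorem norm_neg_I_mul_cpow_mul_le {M α : ℝ} {z : ℂ} (hz : z ∈ Complex.slitPlane) (hM : 0 ≤ M) :
    ‖-Complex.I * z ^ ((-α : ℝ) : ℂ)‖ * (M / (1 + ‖z‖)) ≤ M * ‖z‖ ^ (-1 - α) := by
  have hpos : 0 < ‖z‖ := norm_pos_iff.2 (Complex.slitPlane_ne_zero hz)
  rw [norm_mul, norm_neg, Complex.norm_I, one_mul, Complex.norm_cpow_real]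
  have h1 : ‖z‖ ^ (-1 - α) = ‖z‖ ^ (-α) * ‖z‖⁻¹ := by
    rw [show -1 - α = -α + -1 by ring, Real.rpow_add hpos, Real.rpow_neg_one]
  rw [h1]
  have h2 : M / (1 + ‖z‖) ≤ M * ‖z‖⁻¹ := by
    rw [← div_eq_mul_inv]
    gcongr
    linarith
  calc _ ≤ ‖z‖ ^ (-α) * (M * ‖z‖⁻¹) := by gcongr
    _ = _ := by ring

variable [CompleteSpace A] {W : Set ℂ} {P K : ℂ → A}

theorem IsSlicePair.exists_tendsto_rightForm (h : IsSlicePair W P K) (φ : ℂ →ₐ[ℝ] A)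
    (hφ : ∀ c, ‖φ c‖ ≤ ‖c‖) {θ a : ℝ} (ha : 0 < a) (hθ : θ ∈ Ioo 0 Real.pi)
    (hsub : slitSector θ a ⊆ W) {M : ℝ} (hM : 0 ≤ M)
    (hb : ∀ z ∈ slitSector θ a, ‖sliceRight φ P K z‖ ≤ M / (1 + ‖z‖)) {α : ℝ} (hα : 0 < α) :
    ∃ L : A, ∀ g, IsSectorPath θ a g →
      (∀ b c, IntervalIntegrable (rightForm φ P K α g) volume b c) ∧
      Tendsto (fun p : ℝ × ℝ => ∫ t in p.1..p.2, rightForm φ P K α g t) (atBot ×ˢ atTop)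
        (𝓝 L) := by
  have hd := h.differentiableOn_sliceRight φ hφ
  -- All scalar factors lie in the commutative image of φ, so `deriv g` can be moved outside and act
  -- as a complex scalar.
  have heq : ∀ g : ℝ → ℂ, rightForm φ P K α g = fun t => φ (deriv g t) *
      (φ (-Complex.I * g t ^ ((-α : ℝ) : ℂ)) * sliceRight φ P K (g t)) := by
    intro g
    funext t
    rw [rightForm, ← mul_assoc, ← map_mul, ← map_mul]
    congr 2
    ring
  simp only [heq]
  -- The complex structure depends on φ; it is compatible with the given real one because φ is real
  -- linear.
  have hS : @IsScalarTower ℝ ℂ A Algebra.toSMul (leftComplexStructure φ hφ).toModule.toSMul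
      Algebra.toSMul := @IsScalarTower.mk _ _ _ _ (_) _ fun r c x => by
    change φ (r • c) * x = r • (φ c * x)
    rw [map_smul, smul_mul_assoc]
  let S := leftComplexStructure φ hφ
  refine @exists_tendsto_integral_sectorPath A _ (NormedAlgebra.toNormedSpace A) _ S hS θ a ha hθ
    (W ∩ Complex.slitPlane) (h.isOpen.inter Complex.isOpen_slitPlane)
    (fun z hz => ⟨hsub hz, hz.1⟩)
    (fun z => (-Complex.I * z ^ ((-α : ℝ) : ℂ)) • sliceRight φ P K z) ?_ M α hM hα ?_
  · intro z hz
    exact (differentiableAt_neg_I_mul_cpow hz.2 _).differentiableWithinAt.smul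
      (hd.mono inter_subset_left z hz)
  · intro z hz
    refine (norm_mul_le _ _).trans ?_
    exact (mul_le_mul (hφ _) (hb z hz) (norm_nonneg _) (norm_nonneg _)).trans
      (norm_neg_I_mul_cpow_mul_le hz.1 hM)

theorem IsSlicePair.exists_tendsto_leftForm (h : IsSlicePair W P K) (φ : ℂ →ₐ[ℝ] A)
    (hφ : ∀ c, ‖φ c‖ ≤ ‖c‖) {θ a : ℝ} (ha : 0 < a) (hθ : θ ∈ Ioo 0 Real.pi)
    (hsub : slitSector θ a ⊆ W) {M : ℝ} (hM : 0 ≤ M)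
    (hb : ∀ z ∈ slitSector θ a, ‖sliceLeft φ P K z‖ ≤ M / (1 + ‖z‖)) {α : ℝ} (hα : 0 < α) :
    ∃ L : A, ∀ g, IsSectorPath θ a g →
      (∀ b c, IntervalIntegrable (leftForm φ P K α g) volume b c) ∧
      Tendsto (fun p : ℝ × ℝ => ∫ t in p.1..p.2, leftForm φ P K α g t) (atBot ×ˢ atTop)
        (𝓝 L) := by
  have hd := h.differentiableOn_sliceLeft φ hφ
  have heq : ∀ g : ℝ → ℂ, leftForm φ P K α g = fun t =>
      (sliceLeft φ P K (g t) * φ (-Complex.I * g t ^ ((-α : ℝ) : ℂ))) * φ (deriv g t) := by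
    intro g
    funext t
    rw [leftForm, mul_assoc, mul_assoc, ← map_mul, ← map_mul]
    congr 2
    ring
  simp only [heq]
  have hS : @IsScalarTower ℝ ℂ A Algebra.toSMul (rightComplexStructure φ hφ).toModule.toSMul
      Algebra.toSMul := @IsScalarTower.mk _ _ _ _ (_) _ fun r c x => by
    change x * φ (r • c) = r • (x * φ c)
    rw [map_smul, mul_smul_comm]
  let S := rightComplexStructure φ hφ
  refine @exists_tendsto_integral_sectorPath A _ (NormedAlgebra.toNormedSpace A) _ S hS θ a ha hθ
    (W ∩ Complex.slitPlane) (h.isOpen.inter Complex.isOpen_slitPlane)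
    (fun z hz => ⟨hsub hz, hz.1⟩)
    (fun z => (-Complex.I * z ^ ((-α : ℝ) : ℂ)) • sliceLeft φ P K z) ?_ M α hM hα ?_
  · intro z hz
    exact (differentiableAt_neg_I_mul_cpow hz.2 _).differentiableWithinAt.smul
      (hd.mono inter_subset_left z hz)
  · intro z hz
    refine (norm_mul_le _ _).trans ?_
    rw [mul_comm]
    exact (mul_le_mul (hφ _) (hb z hz) (norm_nonneg _) (norm_nonneg _)).trans
      (norm_neg_I_mul_cpow_mul_le hz.1 hM)

end SliceIntegral

/-! ### Pairing conjugate points on a wedge -/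

section Wedge

/-- The boundary of a sector with vertex `a`, run through from the upper to the lower ray. -/
noncomputable def wedge (θ a t : ℝ) : ℂ := ⟨a + |t| * Real.cos θ, -(t * Real.sin θ)⟩

@[simp] theorem wedge_re (θ a t : ℝ) : (wedge θ a t).re = a + |t| * Real.cos θ := rfl

@[simp] theorem wedge_im (θ a t : ℝ) : (wedge θ a t).im = -(t * Real.sin θ) := rfl

theorem wedge_neg (θ a t : ℝ) : wedge θ a (-t) = (starRingEnd ℂ) (wedge θ a t) := by
  apply Complex.ext <;> simp

theorem deriv_wedge_neg (θ a t : ℝ) :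
    deriv (wedge θ a) (-t) = -(starRingEnd ℂ) (deriv (wedge θ a) t) := by
  have h1 : deriv (fun t => wedge θ a (-t)) t = -deriv (wedge θ a) (-t) :=
    deriv_comp_neg (wedge θ a) t
  have h2 : deriv (fun t => star (wedge θ a t)) t = star (deriv (wedge θ a) t) := deriv.star
  have h3 : (fun t => wedge θ a (-t)) = fun t => star (wedge θ a t) := by
    funext t
    exact wedge_neg θ a t
  rw [h3, h2] at h1
  rw [← neg_eq_iff_eq_neg, ← h1]
  rfl

theorem wedge_mem_slitPlane {θ a : ℝ} (ha : 0 < a) (hθ : θ ∈ Ioo 0 Real.pi) (t : ℝ) :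
    wedge θ a t ∈ Complex.slitPlane := by
  rw [Complex.mem_slitPlane_iff]
  by_cases h : t = 0
  · left; simpa [h] using ha
  · right
    simpa using ⟨h, (Real.sin_pos_of_pos_of_lt_pi hθ.1 hθ.2).ne'⟩

theorem contDiffOn_wedge (θ a : ℝ) {s : Set ℝ} (hs : s ⊆ Ici 0 ∨ s ⊆ Iic 0) :
    ContDiffOn ℝ 1 (wedge θ a) s := by
  have h1 : wedge θ a = fun t => (a : ℂ) + (|t| : ℝ) * (Real.cos θ : ℂ) -
      (t : ℂ) * (Real.sin θ * Complex.I) := by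
    funext t
    apply Complex.ext <;> simp [-Complex.ofReal_cos, -Complex.ofReal_sin]
  have hof : ContDiff ℝ 1 (fun t : ℝ => (t : ℂ)) := Complex.ofRealCLM.contDiff
  have habs : ContDiffOn ℝ 1 (fun t : ℝ => ((|t| : ℝ) : ℂ)) s := by
    rcases hs with hs | hs
    · exact hof.contDiffOn.congr fun t ht => by rw [abs_of_nonneg (hs ht)]
    · refine hof.neg.contDiffOn.congr fun t ht => ?_
      rw [abs_of_nonpos (hs ht), Complex.ofReal_neg]
  rw [h1]
  exact (contDiffOn_const.add (habs.mul contDiffOn_const)).sub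
    (hof.contDiffOn.mul contDiffOn_const)

theorem isSectorPath_wedge {θ θ' a a' : ℝ} (ha' : 0 < a') (haa : a' ≤ a)
    (hθ : θ ∈ Ioo 0 Real.pi) (hθ' : θ' ∈ Ioo θ Real.pi) :
    IsSectorPath θ a (wedge θ' a') := by
  have hθ0 : θ' ∈ Ioo 0 Real.pi := ⟨hθ.1.trans hθ'.1, hθ'.2⟩
  have hsin : 0 < Real.sin θ' := Real.sin_pos_of_pos_of_lt_pi hθ0.1 hθ0.2
  have hnorm : ∀ t, |t| * Real.sin θ' ≤ ‖wedge θ' a' t‖ := by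
    intro t
    have := Complex.abs_im_le_norm (wedge θ' a' t)
    rwa [wedge_im, abs_neg, abs_mul, abs_of_pos hsin] at this
  refine ⟨fun t => ?_, fun t => ⟨wedge_mem_slitPlane ha' hθ0 t, ?_⟩, ?_, ?_, ?_, ?_⟩
  · rcases lt_trichotomy t 0 with ht | rfl | ht
    · exact ⟨-t, by linarith,
        contDiffOn_wedge _ _ (Or.inr fun s hs => hs.2.trans ht.le),
        contDiffOn_wedge _ _ (Or.inr fun s hs => hs.2.trans (by linarith))⟩
    · exact ⟨1, one_pos, contDiffOn_wedge _ _ (Or.inr fun s hs => hs.2),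
        contDiffOn_wedge _ _ (Or.inl fun s hs => hs.1)⟩
    · exact ⟨t, ht, contDiffOn_wedge _ _ (Or.inl fun s hs => by simpa using hs.1),
        contDiffOn_wedge _ _ (Or.inl fun s hs => ht.le.trans hs.1)⟩
  · have h1 : ‖wedge θ' a' t - a'‖ = |t| := by
      have h2 : ‖wedge θ' a' t - a'‖ ^ 2 = |t| ^ 2 := by
        rw [Complex.sq_norm, Complex.normSq_apply]
        simp only [Complex.sub_re, wedge_re, Complex.ofReal_re, Complex.sub_im, wedge_im,
          Complex.ofReal_im, sq_abs]
        have h3 := Real.sin_sq_add_cos_sq θ'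
        have h4 := sq_abs t
        linear_combination t ^ 2 * h3 + Real.cos θ' ^ 2 * h4
      exact (pow_left_inj₀ (norm_nonneg _) (abs_nonneg _) two_ne_zero).1 h2
    -- Moving the vertex from a' to a changes distances by at most a - a', and |cos θ| ≤ 1, so the
    -- horizontal shift absorbs the error.
    have h2 : abs (‖wedge θ' a' t - a‖ - |t|) ≤ a - a' := by
      rw [← h1]
      refine (abs_norm_sub_norm_le _ _).trans ?_
      rw [sub_sub_sub_cancel_left, ← Complex.ofReal_sub, Complex.norm_real, Real.norm_eq_abs,
        abs_sub_comm, abs_of_nonneg (by linarith)]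
    have h3 : Real.cos θ' ≤ Real.cos θ :=
      Real.cos_le_cos_of_nonneg_of_le_pi hθ.1.le hθ'.2.le hθ'.1.le
    have h4 := Real.abs_cos_le_one θ
    have h5 : abs (Real.cos θ * (‖wedge θ' a' t - a‖ - |t|)) ≤ 1 * (a - a') := by
      rw [abs_mul]
      gcongr
    have h6 := (abs_le.1 h5).1
    simp only [Complex.sub_re, wedge_re, Complex.ofReal_re]
    nlinarith [mul_le_mul_of_nonneg_left h3 (abs_nonneg t)]
  · exact tendsto_atTop_mono hnorm (tendsto_abs_atBot_atTop.atTop_mul_const hsin)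
  · exact tendsto_atTop_mono hnorm (tendsto_abs_atTop_atTop.atTop_mul_const hsin)
  · filter_upwards [eventually_lt_atBot 0] with t ht
    simpa using mul_neg_of_neg_of_pos ht hsin
  · filter_upwards [eventually_gt_atTop 0] with t ht
    simpa using mul_pos ht hsin

variable {A : Type*} [NormedRing A] [NormedAlgebra ℝ A]

/-- The sum of the values of the integrands on a wedge at conjugate points. -/
noncomputable def wedgeForm (P K : ℂ → A) (α θ a t : ℝ) : A :=
  (2 * (-Complex.I * deriv (wedge θ a) t * wedge θ a t ^ ((-α : ℝ) : ℂ)).re) •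
      ((wedge θ a t).re • P (wedge θ a t) - K (wedge θ a t)) +
    (2 * (-Complex.I * deriv (wedge θ a) t * wedge θ a t ^ ((-α : ℝ) : ℂ)).im) •
      ((wedge θ a t).im • P (wedge θ a t))

/-- The sign from reversing the parameter cancels the sign from conjugating -i. -/
theorem wedge_coefficient_neg {α θ a : ℝ} (ha : 0 < a) (hθ : θ ∈ Ioo 0 Real.pi) (t : ℝ) :
    -Complex.I * deriv (wedge θ a) (-t) * wedge θ a (-t) ^ ((-α : ℝ) : ℂ) =
      (starRingEnd ℂ) (-Complex.I * deriv (wedge θ a) t * wedge θ a t ^ ((-α : ℝ) : ℂ)) := by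
  have h : (wedge θ a t).arg ≠ Real.pi := (Complex.mem_slitPlane_iff_arg.1
    (wedge_mem_slitPlane ha hθ t)).1
  rw [deriv_wedge_neg, wedge_neg, Complex.conj_cpow _ _ h]
  simp

theorem integral_neg_eq_of_add {E : Type*} [NormedAddCommGroup E] [NormedSpace ℝ E] {h k : ℝ → E}
    (hint : ∀ b c, IntervalIntegrable h volume b c) (hk : ∀ t, h (-t) + h t = k t) (R : ℝ) :
    ∫ t in -R..R, h t = ∫ t in 0..R, k t := by
  rw [← intervalIntegral.integral_add_adjacent_intervals (hint (-R) 0) (hint 0 R)]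
  have h1 : ∫ t in -R..0, h t = ∫ t in 0..R, h (-t) := by
    rw [intervalIntegral.integral_comp_neg, neg_zero]
  have h2 : IntervalIntegrable (fun t => h (-t)) volume 0 R := by
    simpa using (IntervalIntegrable.comp_sub_left (hint 0 (-R)) 0)
  rw [h1, ← intervalIntegral.integral_add h2 (hint 0 R)]
  exact intervalIntegral.integral_congr fun t _ => hk t

/-- With j = φ(i), c (X - j Y) + c̄ (X + j Y) = 2 Re(c) X + 2 Im(c) Y. Only j² = -1 is used, and j
disappears. -/
theorem integral_rightForm_wedge {P K : ℂ → A} {φ : ℂ →ₐ[ℝ] A} {α θ a : ℝ} (ha : 0 < a)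
    (hθ : θ ∈ Ioo 0 Real.pi)
    (hP : ∀ t, P (wedge θ a (-t)) = P (wedge θ a t)) (hK : ∀ t, K (wedge θ a (-t)) = K (wedge θ a t))
    (hint : ∀ b c, IntervalIntegrable (rightForm φ P K α (wedge θ a)) volume b c) (R : ℝ) :
    ∫ t in -R..R, rightForm φ P K α (wedge θ a) t = ∫ t in 0..R, wedgeForm P K α θ a t := by
  refine integral_neg_eq_of_add hint (fun t => ?_) R
  have hform : ∀ t, rightForm φ P K α (wedge θ a) t =
      φ (-Complex.I * deriv (wedge θ a) t * wedge θ a t ^ ((-α : ℝ) : ℂ)) *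
        sliceRight φ P K (wedge θ a t) := fun t => by
    rw [rightForm, ← map_mul, mul_comm (wedge θ a t ^ _)]
  rw [hform, hform, wedge_coefficient_neg ha hθ, wedgeForm, sliceRight_eq, sliceRight_eq, hP, hK,
    wedge_neg, Complex.conj_re, Complex.conj_im]
  generalize -Complex.I * deriv (wedge θ a) t * wedge θ a t ^ ((-α : ℝ) : ℂ) = c
  rw [algHom_complex_apply φ c, algHom_complex_apply φ (starRingEnd ℂ c), Complex.conj_re,
    Complex.conj_im]
  generalize (wedge θ a t).re • P (wedge θ a t) - K (wedge θ a t) = X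
  rw [neg_smul _ (P _)]
  generalize (wedge θ a t).im • P (wedge θ a t) = Y
  have hY : φ Complex.I * (φ Complex.I * Y) = -Y := by
    rw [← mul_assoc, algHom_I_mul_I, neg_mul, one_mul]
  simp only [add_mul, mul_sub, mul_neg, one_mul, hY, smul_mul_assoc]
  module

/-- The same cancellation with j on the right. Arriving at the same `wedgeForm` is what identifies
the left with the right integral. -/
theorem integral_leftForm_wedge {P K : ℂ → A} {φ : ℂ →ₐ[ℝ] A} {α θ a : ℝ} (ha : 0 < a)
    (hθ : θ ∈ Ioo 0 Real.pi)
    (hP : ∀ t, P (wedge θ a (-t)) = P (wedge θ a t)) (hK : ∀ t, K (wedge θ a (-t)) = K (wedge θ a t))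
    (hint : ∀ b c, IntervalIntegrable (leftForm φ P K α (wedge θ a)) volume b c) (R : ℝ) :
    ∫ t in -R..R, leftForm φ P K α (wedge θ a) t = ∫ t in 0..R, wedgeForm P K α θ a t := by
  refine integral_neg_eq_of_add hint (fun t => ?_) R
  have hform : ∀ t, leftForm φ P K α (wedge θ a) t = sliceLeft φ P K (wedge θ a t) *
      φ (-Complex.I * deriv (wedge θ a) t * wedge θ a t ^ ((-α : ℝ) : ℂ)) := fun t => by
    rw [leftForm, mul_assoc, ← map_mul]
  rw [hform, hform, wedge_coefficient_neg ha hθ, wedgeForm, sliceLeft_eq, sliceLeft_eq, hP, hK,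
    wedge_neg, Complex.conj_re, Complex.conj_im]
  generalize -Complex.I * deriv (wedge θ a) t * wedge θ a t ^ ((-α : ℝ) : ℂ) = c
  rw [algHom_complex_apply φ c, algHom_complex_apply φ (starRingEnd ℂ c), Complex.conj_re,
    Complex.conj_im]
  generalize (wedge θ a t).re • P (wedge θ a t) - K (wedge θ a t) = X
  rw [neg_smul _ (P _)]
  generalize (wedge θ a t).im • P (wedge θ a t) = Y
  have hY : Y * φ Complex.I * φ Complex.I = -Y := by
    rw [mul_assoc, algHom_I_mul_I, mul_neg, mul_one]
  simp only [mul_add, sub_mul, neg_mul, mul_one, hY, mul_smul_comm]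
  module

end Wedge

end QuatFrac
namespace QuatFrac

/-! ### Identification of `ℂ_I` with the complex plane -/

section Slice

theorem imaginaryUnits_mul_self {I : ℍ} (hI : I ∈ imaginaryUnits) : I * I = -1 := by
  have h1 : star I = -I := by
    rw [Quaternion.star_eq_neg]
    exact hI.1
  have h2 : I * star I = 1 := by
    rw [Quaternion.self_mul_star, Quaternion.normSq_eq_norm_mul_self, hI.2]
    simp
  rw [h1, mul_neg] at h2
  rw [← h2, neg_neg]

/-- The embedding of the complex numbers onto the plane `ℂ_I`. -/
noncomputable def slice {I : ℍ} (hI : I ∈ imaginaryUnits) : ℂ →ₐ[ℝ] ℍ :=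
  Complex.lift ⟨I, imaginaryUnits_mul_self hI⟩

variable {I : ℍ} (hI : I ∈ imaginaryUnits)

theorem slice_apply (z : ℂ) : slice hI z = (z.re : ℍ) + z.im • I := rfl

@[simp] theorem slice_I : slice hI Complex.I = I := by simp [slice_apply]

@[simp] theorem slice_ofReal (x : ℝ) : slice hI (x : ℂ) = (x : ℍ) := by simp

@[simp] theorem slice_re (z : ℂ) : (slice hI z).re = z.re := by
  simp [slice_apply, show I.re = 0 from hI.1]

theorem slice_im (z : ℂ) : (slice hI z).im = z.im • I := by
  have : I.im = I := by
    conv_rhs => rw [← Quaternion.re_add_im I, show I.re = 0 from hI.1]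
    simp
  rw [slice_apply, Quaternion.im_add, Quaternion.im_coe, Quaternion.im_smul, this, zero_add]

theorem star_slice (z : ℂ) : star (slice hI z) = slice hI ((starRingEnd ℂ) z) := by
  have h1 : star I = -I := by
    rw [Quaternion.star_eq_neg]
    exact hI.1
  simp [slice_apply, h1]

@[simp] theorem norm_slice (z : ℂ) : ‖slice hI z‖ = ‖z‖ := by
  have h1 : (slice hI z) * star (slice hI z) = ((‖z‖ ^ 2 : ℝ) : ℍ) := by
    rw [star_slice, ← map_mul, Complex.mul_conj, slice_ofReal, Complex.sq_norm]
  rw [Quaternion.self_mul_star, Quaternion.normSq_eq_norm_mul_self, Quaternion.coe_inj, ← sq] at h1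
  exact (pow_left_inj₀ (norm_nonneg _) (norm_nonneg _) two_ne_zero).1 h1

theorem continuous_slice : Continuous (slice hI) :=
  (slice hI).toLinearMap.continuous_of_finiteDimensional

theorem contDiff_slice : ContDiff ℝ 1 (slice hI) :=
  (slice hI).toLinearMap.toContinuousLinearMap.contDiff

/-- The factor |Im z|⁻¹ Im z is the sign of Im z; for z > 0 it is 0, as is the argument. -/
theorem arccos_re_div_norm_smul {z : ℂ} (hz : z ∈ Complex.slitPlane) :
    Real.arccos (z.re / ‖z‖) * (|z.im|⁻¹ * z.im) = z.arg := by
  rcases lt_trichotomy z.im 0 with h | h | h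
  · rw [Complex.arg_of_im_neg h, abs_of_neg h, inv_neg, neg_mul, inv_mul_cancel₀ h.ne, mul_neg_one]
  · have hre : 0 < z.re := (Complex.mem_slitPlane_iff.1 hz).resolve_right (not_not.2 h)
    rw [h, Complex.arg_eq_zero_iff.2 ⟨hre.le, h⟩]
    simp
  · rw [Complex.arg_of_im_pos h, abs_of_pos h, inv_mul_cancel₀ h.ne', mul_one]

theorem qlog_slice {z : ℂ} (hz : z ∈ Complex.slitPlane) :
    qlog (slice hI z) = slice hI (Complex.log z) := by
  rw [qlog, slice_im, norm_smul, norm_slice, slice_re, hI.2, slice_apply, Complex.log_re,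
    Complex.log_im, Real.norm_eq_abs, mul_one, smul_smul, smul_smul, mul_assoc, arccos_re_div_norm_smul hz]

theorem qpow_slice {z : ℂ} (hz : z ∈ Complex.slitPlane) (α : ℝ) :
    qpow (slice hI z) α = slice hI (z ^ (α : ℂ)) := by
  rw [qpow, qlog_slice hI hz, Complex.cpow_def_of_ne_zero (Complex.slitPlane_ne_zero hz),
    Complex.exp_eq_exp_ℂ, NormedSpace.map_exp (slice hI) (continuous_slice hI), ← map_smul,
    Complex.real_smul, mul_comm]

/-- The orthogonal projection onto `ℂ_I`, as a map to the complex numbers. -/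
noncomputable def sliceProj (I : ℍ) : ℍ →L[ℝ] ℂ :=
  LinearMap.toContinuousLinearMap
    { toFun := fun q => ⟨q.re, -(I * q).re⟩
      map_add' := fun p q => by apply Complex.ext <;> simp; ring
      map_smul' := fun r q => by apply Complex.ext <;> simp; ring }

theorem sliceProj_slice (z : ℂ) : sliceProj I (slice hI z) = z := by
  apply Complex.ext
  · exact slice_re hI z
  · change -(I * slice hI z).re = z.im
    have h : I * slice hI z = slice hI (Complex.I * z) := by rw [map_mul, slice_I]
    rw [h, slice_re]
    simp

theorem slice_sliceProj {s : ℍ} (hs : s ∈ slicePlane I) : slice hI (sliceProj I s) = s := by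
  obtain ⟨x, y, rfl⟩ := hs
  have : (x : ℍ) + y • I = slice hI ⟨x, y⟩ := rfl
  rw [this, sliceProj_slice]

theorem slice_mem_slicePlane (z : ℂ) : slice hI z ∈ slicePlane I := ⟨z.re, z.im, rfl⟩

/-- Where g is not differentiable both sides take the default value 0, since `sliceProj` carries
differentiability back to g. -/
theorem deriv_slice_comp (g : ℝ → ℂ) (t : ℝ) :
    deriv (fun t => slice hI (g t)) t = slice hI (deriv g t) := by
  by_cases hg : DifferentiableAt ℝ g t
  · exact ((slice hI).toLinearMap.toContinuousLinearMap.hasFDerivAt.comp_hasDerivAt t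
      hg.hasDerivAt).deriv
  · have : ¬ DifferentiableAt ℝ (fun t => slice hI (g t)) t := fun h => hg (by
      have := (sliceProj I).differentiableAt.comp t h
      simpa only [Function.comp_def, sliceProj_slice] using this)
    rw [deriv_zero_of_not_differentiableAt hg, deriv_zero_of_not_differentiableAt this, map_zero]

theorem slice_mem_nonposReals {z : ℂ} : slice hI z ∈ nonposReals ↔ z ∉ Complex.slitPlane := by
  rw [Complex.mem_slitPlane_iff, not_or, not_lt, not_not]
  constructor
  · rintro ⟨x, hx, h⟩
    rw [← slice_ofReal hI] at h
    have := congrArg (sliceProj I) h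
    rw [sliceProj_slice, sliceProj_slice] at this
    simpa [this] using hx
  · rintro ⟨h1, h2⟩
    exact ⟨z.re, h1, by rw [slice_apply, h2, zero_smul, add_zero]⟩

theorem slice_mem_closedSector {θ a : ℝ} (hθ : θ ∈ Ioo 0 Real.pi) {z : ℂ} :
    slice hI z ∈ closedSector θ a ↔ (z - a).re ≤ Real.cos θ * ‖z - a‖ := by
  by_cases h0 : z = a
  · simp [h0, closedSector]
  have h1 : slice hI z ≠ (a : ℍ) := fun h => h0 (by
    rw [← slice_ofReal hI] at h
    have := congrArg (sliceProj I) h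
    rwa [sliceProj_slice, sliceProj_slice] at this)
  have hpos : 0 < ‖z - a‖ := norm_pos_iff.2 (sub_ne_zero.2 h0)
  have h2 : arg (slice hI z - (a : ℍ)) = Real.arccos ((z - a).re / ‖z - a‖) := by
    rw [← slice_ofReal hI, ← map_sub, arg, slice_re, norm_slice]
  have h3 : (z - a).re / ‖z - a‖ ∈ Icc (-1 : ℝ) 1 := by
    refine abs_le.1 ?_
    rw [abs_div, abs_norm]
    exact div_le_one_of_le₀ (Complex.abs_re_le_norm _) hpos.le
  simp only [closedSector, mem_ofPred_eq, h1, false_or, h2]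
  rw [← div_le_iff₀ hpos, ← Real.strictAntiOn_arccos.le_iff_ge
    ⟨Real.neg_one_le_cos θ, Real.cos_le_one θ⟩ h3, Real.arccos_cos hθ.1.le hθ.2.le]

theorem mem_slitSector_iff {θ a : ℝ} (hθ : θ ∈ Ioo 0 Real.pi) {z : ℂ} :
    z ∈ slitSector θ a ↔ slice hI z ∈ closedSector θ a \ nonposReals := by
  rw [Set.mem_sdiff, slice_mem_closedSector hI hθ, slice_mem_nonposReals hI, not_not, and_comm]
  rfl

end Slice

/-! ### S-resolvents and integrals in the complex coordinate -/

section SliceOperators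

variable {V : Type*} [NormedAddCommGroup V] [NormedSpace ℝ V]
  [Module ℍ V] [Module ℍᵐᵒᵖ V] [SMulCommClass ℍ ℍᵐᵒᵖ V]
  [IsScalarTower ℝ ℍ V] [IsScalarTower ℝ ℍᵐᵒᵖ V]
  [NormSMulClass ℍ V] [NormSMulClass ℍᵐᵒᵖ V]

variable (V) in
/-- Left multiplication by the elements of `ℂ_I`. -/
noncomputable def sliceMul {I : ℍ} (hI : I ∈ imaginaryUnits) : ℂ →ₐ[ℝ] BoundedOp V where
  toFun z := leftMul (slice hI z)
  map_one' := by rw [map_one, leftMul_one]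
  map_mul' z w := by rw [map_mul, leftMul_mul]
  map_zero' := BoundedOp.ext fun v => by rw [map_zero, leftMul_apply, zero_smul]; rfl
  map_add' z w := by rw [map_add, leftMul_add]
  commutes' r := by
    rw [Complex.coe_algebraMap, slice_ofReal, leftMul_coe, Algebra.algebraMap_eq_smul_one]

theorem sliceMul_apply {I : ℍ} (hI : I ∈ imaginaryUnits) (z : ℂ) :
    sliceMul V hI z = leftMul (slice hI z) := rfl

theorem norm_sliceMul_le {I : ℍ} (hI : I ∈ imaginaryUnits) (z : ℂ) : ‖sliceMul V hI z‖ ≤ ‖z‖ :=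
  (norm_leftMul_le _).trans (norm_slice hI z).le

variable [CompleteSpace V] {T : ClosedOp V}

theorem isPseudoResolvent_congr {s t : ℍ} (hre : s.re = t.re) (hn : ‖s‖ = ‖t‖) (B : BoundedOp V) :
    IsPseudoResolvent T s B ↔ IsPseudoResolvent T t B := by
  rw [isPseudoResolvent_iff, isPseudoResolvent_iff, hre, hn]

theorem mem_resolventSet_congr {s t : ℍ} (hre : s.re = t.re) (hn : ‖s‖ = ‖t‖) :
    s ∈ resolventSet T ↔ t ∈ resolventSet T :=
  exists_congr (isPseudoResolvent_congr hre hn)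

/-- Q_s(T) involves s only through Re s and |s|; off the resolvent set both sides are the default 0.
-/
theorem pseudoRes_eq_of_re_norm {s t : ℍ} (hre : s.re = t.re) (hn : ‖s‖ = ‖t‖) :
    pseudoRes T s = pseudoRes T t := by
  by_cases hs : s ∈ resolventSet T
  · exact pseudoRes_congr hs ((mem_resolventSet_congr hre hn).1 hs) hre hn
  · have ht : t ∉ resolventSet T := fun h => hs ((mem_resolventSet_congr hre hn).2 h)
    rw [pseudoRes, pseudoRes, dif_neg hs, dif_neg ht]

theorem opRes_eq_of_re_norm {s t : ℍ} (hre : s.re = t.re) (hn : ‖s‖ = ‖t‖) :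
    opRes T s = opRes T t := by
  refine BoundedOp.ext fun w => ?_
  have h1 := maps_opRes T s w
  rw [pseudoRes_eq_of_re_norm hre hn] at h1
  exact h1.unique (maps_opRes T t w)

/-- An imaginary unit. -/
def stdUnit : ℍ := ⟨0, 1, 0, 0⟩

theorem stdUnit_mem : stdUnit ∈ imaginaryUnits := by
  refine ⟨rfl, ?_⟩
  have h : Quaternion.normSq stdUnit = 1 := by
    rw [Quaternion.normSq_def']; simp [stdUnit]
  rw [Quaternion.normSq_eq_norm_mul_self] at h
  nlinarith [norm_nonneg stdUnit]

variable (T) in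
/-- The pseudo-resolvent as a function of a complex variable. -/
noncomputable def planeRes (z : ℂ) : BoundedOp V := pseudoRes T (slice stdUnit_mem z)

variable (T) in
/-- The operator applied to the pseudo-resolvent, as a function of a complex variable. -/
noncomputable def planeOp (z : ℂ) : BoundedOp V := opRes T (slice stdUnit_mem z)

theorem planeRes_conj (z : ℂ) : planeRes T ((starRingEnd ℂ) z) = planeRes T z :=
  pseudoRes_eq_of_re_norm (by simp) (by simp)

theorem planeOp_conj (z : ℂ) : planeOp T ((starRingEnd ℂ) z) = planeOp T z :=
  opRes_eq_of_re_norm (by simp) (by simp)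

variable (T) in
theorem isSlicePair_plane :
    IsSlicePair (slice stdUnit_mem ⁻¹' resolventSet T) (planeRes T) (planeOp T) where
  isOpen := (isOpen_resolventSet T).preimage (continuous_slice _)
  continuousAt_fst z hz := (continuousAt_pseudoRes hz).comp (continuous_slice _).continuousAt
  continuousAt_snd z hz := (continuousAt_opRes hz).comp (continuous_slice _).continuousAt
  comm w hw z hz := pseudoRes_mul_opRes hw
  mul w hw z hz := by simpa [planeRes, planeOp] using opRes_mul_opRes_left hw hz
  sub_fst w hw z hz := by simpa [planeRes, planeOp] using pseudoRes_sub hw hz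
  sub_snd w hw z hz := by simpa [planeRes, planeOp] using opRes_sub hw hz

theorem resolventR_slice {I : ℍ} (hI : I ∈ imaginaryUnits) (z : ℂ) :
    resolventR T (slice hI z) = sliceRight (sliceMul V hI) (planeRes T) (planeOp T) z := by
  rw [resolventR_eq, star_slice, sliceRight, sliceMul_apply, planeRes, planeOp,
    pseudoRes_eq_of_re_norm (t := slice stdUnit_mem z) (by simp) (by simp),
    opRes_eq_of_re_norm (t := slice stdUnit_mem z) (by simp) (by simp)]

theorem resolventL_slice {I : ℍ} (hI : I ∈ imaginaryUnits) (z : ℂ) :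
    resolventL T (slice hI z) = sliceLeft (sliceMul V hI) (planeRes T) (planeOp T) z := by
  rw [resolventL_eq, star_slice, sliceLeft, sliceMul_apply, planeRes, planeOp,
    pseudoRes_eq_of_re_norm (t := slice stdUnit_mem z) (by simp) (by simp),
    opRes_eq_of_re_norm (t := slice stdUnit_mem z) (by simp) (by simp)]

theorem rightIntegral_slice {I : ℍ} (hI : I ∈ imaginaryUnits) (α : ℝ) {g : ℝ → ℂ}
    (hg : ∀ t, g t ∈ Complex.slitPlane) (p : ℝ × ℝ) :
    rightIntegral T I (fun t => slice hI (g t)) α p = (2 * Real.pi)⁻¹ •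
      ∫ t in p.1..p.2, rightForm (sliceMul V hI) (planeRes T) (planeOp T) α g t := by
  rw [rightIntegral]
  congr 1
  refine intervalIntegral.integral_congr fun t _ => ?_
  simp only [qpow_slice hI (hg t), deriv_slice_comp, resolventR_slice, rightForm, sliceMul_apply,
    map_mul (slice hI), map_neg (slice hI), slice_I]

theorem leftIntegral_slice {I : ℍ} (hI : I ∈ imaginaryUnits) (α : ℝ) {g : ℝ → ℂ}
    (hg : ∀ t, g t ∈ Complex.slitPlane) (p : ℝ × ℝ) :
    leftIntegral T I (fun t => slice hI (g t)) α p = (2 * Real.pi)⁻¹ •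
      ∫ t in p.1..p.2, leftForm (sliceMul V hI) (planeRes T) (planeOp T) α g t := by
  rw [leftIntegral]
  congr 1
  refine intervalIntegral.integral_congr fun t _ => ?_
  simp only [qpow_slice hI (hg t), deriv_slice_comp, resolventL_slice, leftForm, sliceMul_apply,
    map_mul (slice hI), map_neg (slice hI), slice_I]

end SliceOperators

end QuatFrac
namespace QuatFrac

/-! ### Admissible paths and comparison of limits -/

section Admissible

theorem tendsto_norm_inv_smul {E : Type*} [NormedAddCommGroup E] [NormedSpace ℝ E] {l : Filter ℝ}
    {w : ℝ → E} {r : ℝ → ℝ} {c : E} (hr : ∀ᶠ t in l, 0 < r t) (hc : ‖c‖ = 1)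
    (h : Tendsto (fun t => (r t)⁻¹ • w t) l (𝓝 c)) :
    Tendsto (fun t => ‖w t‖⁻¹ • w t) l (𝓝 c) := by
  have h1 := (h.norm.inv₀ (by rw [hc]; exact one_ne_zero)).smul h
  rw [hc, inv_one, one_smul] at h1
  refine h1.congr' ?_
  filter_upwards [hr] with t ht
  rw [norm_smul, norm_inv, Real.norm_eq_abs, abs_of_pos ht, smul_smul, mul_inv, inv_inv,
    mul_right_comm, mul_inv_cancel₀ ht.ne', one_mul]

/-- ε is the sign of t along `l`, so both ends of the wedge are treated at once. -/
theorem tendsto_wedge_direction {θ a ε : ℝ} {l : Filter ℝ} (hl : Tendsto (fun t => |t|) l atTop)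
    (hε : ∀ᶠ t in l, t = ε * |t|) (hε2 : ε ^ 2 = 1) :
    Tendsto (fun t => ‖wedge θ a t‖⁻¹ • wedge θ a t) l
      (𝓝 ((Real.cos θ : ℂ) - (ε * Real.sin θ : ℝ) * Complex.I)) := by
  refine tendsto_norm_inv_smul (r := fun t => |t|) (hl.eventually_gt_atTop 0) ?_ ?_
  · have : ‖(Real.cos θ : ℂ) - (ε * Real.sin θ : ℝ) * Complex.I‖ ^ 2 = 1 ^ 2 := by
      rw [Complex.sq_norm, Complex.normSq_apply]
      simp only [Complex.sub_re, Complex.sub_im, Complex.ofReal_re, Complex.ofReal_im,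
        Complex.mul_re, Complex.mul_im, Complex.I_re, Complex.I_im]
      linear_combination Real.sin_sq_add_cos_sq θ + Real.sin θ ^ 2 * hε2
    exact (pow_left_inj₀ (norm_nonneg _) zero_le_one two_ne_zero).1 this
  · have h1 : Tendsto (fun t : ℝ => ((|t|⁻¹ * a : ℝ) : ℂ) +
        ((Real.cos θ : ℂ) - (ε * Real.sin θ : ℝ) * Complex.I)) l
        (𝓝 (((0 * a : ℝ) : ℂ) + ((Real.cos θ : ℂ) - (ε * Real.sin θ : ℝ) * Complex.I))) :=
      ((Complex.continuous_ofReal.tendsto _).comp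
        ((tendsto_inv_atTop_zero.comp hl).mul_const a)).add_const _
    rw [zero_mul, Complex.ofReal_zero, zero_add] at h1
    refine h1.congr' ?_
    filter_upwards [hε, hl.eventually_gt_atTop 0] with t ht ht0
    apply Complex.ext
    · simp only [Complex.add_re, Complex.sub_re, Complex.ofReal_re, Complex.mul_re, Complex.I_re,
        Complex.ofReal_im, Complex.I_im, Complex.real_smul, wedge_re, wedge_im]
      field_simp
      ring
    · simp only [Complex.add_im, Complex.sub_im, Complex.ofReal_re, Complex.mul_im, Complex.I_re,
        Complex.ofReal_im, Complex.I_im, Complex.real_smul, wedge_re, wedge_im]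
      have h2 : |t|⁻¹ * t = ε := by
        conv_lhs => rw [ht]
        rw [abs_mul, abs_abs]
        have h3 : |ε| = 1 := by
          rw [← sq_abs] at hε2
          exact (pow_left_inj₀ (abs_nonneg _) zero_le_one two_ne_zero).1 (by rw [hε2, one_pow])
        rw [h3, one_mul]
        field_simp
      linear_combination Real.sin θ * h2

variable {V : Type*} [NormedAddCommGroup V] [NormedSpace ℝ V]
  [Module ℍ V] [Module ℍᵐᵒᵖ V] [SMulCommClass ℍ ℍᵐᵒᵖ V]
  [IsScalarTower ℝ ℍ V] [IsScalarTower ℝ ℍᵐᵒᵖ V]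
  [NormSMulClass ℍ V] [NormSMulClass ℍᵐᵒᵖ V] [CompleteSpace V] {T : ClosedOp V}

theorem IsAdmissiblePath.exists_sectorPath {I : ℍ} {γ : ℝ → ℍ} (h : IsAdmissiblePath T I γ) :
    ∃ (hI : I ∈ imaginaryUnits) (a₀ θ₀ : ℝ) (g : ℝ → ℂ), IsResolventSector T a₀ θ₀ ∧
      IsSectorPath θ₀ a₀ g ∧ γ = fun t => slice hI (g t) := by
  obtain ⟨hI, hpc, a₀, θ₀, θ, hsec, hθ, hmem, hbot, htop, hdbot, hdtop⟩ := h
  have hγ : ∀ t, slice hI (sliceProj I (γ t)) = γ t := fun t => slice_sliceProj hI (hmem t).1.2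
  have hnorm : ∀ t, ‖sliceProj I (γ t)‖ = ‖γ t‖ := fun t => by
    rw [← norm_slice hI, hγ]
  have hθ0 := hsec.angle_mem
  have hsin : 0 < Real.sin θ := Real.sin_pos_of_pos_of_lt_pi (hθ0.1.trans hθ.1) hθ.2
  have hcd : ContDiff ℝ 1 (sliceProj I) := (sliceProj I).contDiff
  -- As sin θ > 0, the limiting directions fix the sign of the imaginary part near both ends.
  have him : ∀ (l : Filter ℝ) (σ : ℝ), Tendsto (fun t => ‖γ t‖⁻¹ • γ t) l
      (𝓝 ((Real.cos θ : ℍ) + σ • I)) →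
      Tendsto (fun t => ‖γ t‖⁻¹ * (sliceProj I (γ t)).im) l (𝓝 σ) := by
    intro l σ hl
    have h1 := (Complex.continuous_im.tendsto _).comp (((sliceProj I).continuous.tendsto _).comp hl)
    have h2 : (Real.cos θ : ℍ) + σ • I = slice hI ⟨Real.cos θ, σ⟩ := rfl
    rw [h2, sliceProj_slice] at h1
    refine h1.congr fun t => ?_
    simp
  refine ⟨hI, a₀, θ₀, fun t => sliceProj I (γ t), hsec, ⟨fun t => ?_, fun t => ?_, ?_, ?_, ?_, ?_⟩,
    funext fun t => (hγ t).symm⟩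
  · obtain ⟨ε, hε, h1, h2⟩ := hpc t
    exact ⟨ε, hε, hcd.comp_contDiffOn h1, hcd.comp_contDiffOn h2⟩
  · rw [mem_slitSector_iff hI hθ0, hγ]
    exact ⟨(hmem t).1.1, (hmem t).2⟩
  · simpa only [hnorm] using hbot
  · simpa only [hnorm] using htop
  · filter_upwards [(him atBot _ hdbot).eventually_const_lt hsin] with t ht
    exact pos_of_mul_pos_right ht (by positivity)
  · rw [sub_eq_add_neg, ← neg_smul] at hdtop
    filter_upwards [(him atTop _ hdtop).eventually_lt_const (neg_lt_zero.2 hsin)] with t ht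
    by_contra hcon
    exact absurd ht (not_lt.2 (mul_nonneg (by positivity) (not_lt.1 hcon)))

theorem isAdmissiblePath_wedge {I : ℍ} (hI : I ∈ imaginaryUnits) {a₀ θ₀ θ : ℝ}
    (h : IsResolventSector T a₀ θ₀) (hθ : θ ∈ Ioo θ₀ Real.pi) :
    IsAdmissiblePath T I (fun t => slice hI (wedge θ a₀ t)) := by
  have hw := isSectorPath_wedge h.vertex_pos le_rfl h.angle_mem hθ
  have hdir : ∀ (l : Filter ℝ) (c : ℂ), Tendsto (fun t => ‖wedge θ a₀ t‖⁻¹ • wedge θ a₀ t) l (𝓝 c) →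
      Tendsto (fun t => ‖slice hI (wedge θ a₀ t)‖⁻¹ • slice hI (wedge θ a₀ t)) l
        (𝓝 (slice hI c)) := by
    intro l c hc
    refine (((continuous_slice hI).tendsto c).comp hc).congr fun t => ?_
    simp only [Function.comp_apply, map_smul, norm_slice]
  refine ⟨hI, fun t => ?_, a₀, θ₀, θ, h, hθ, fun t => ?_, ?_, ?_, ?_, ?_⟩
  · obtain ⟨ε, hε, h1, h2⟩ := hw.piecewise t
    exact ⟨ε, hε, (contDiff_slice hI).comp_contDiffOn h1, (contDiff_slice hI).comp_contDiffOn h2⟩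
  · have := (mem_slitSector_iff hI h.angle_mem).1 (hw.mem t)
    exact ⟨⟨this.1, slice_mem_slicePlane hI _⟩, this.2⟩
  · simpa only [norm_slice] using hw.tendsto_atBot
  · simpa only [norm_slice] using hw.tendsto_atTop
  · have h1 := hdir atBot _ (tendsto_wedge_direction (θ := θ) (a := a₀) (ε := -1)
      tendsto_abs_atBot_atTop
      ((eventually_le_atBot 0).mono fun t ht => by rw [abs_of_nonpos ht]; ring) (by norm_num))
    have h2 : slice hI ((Real.cos θ : ℂ) - (-1 * Real.sin θ : ℝ) * Complex.I) =
        (Real.cos θ : ℍ) + Real.sin θ • I := by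
      rw [slice_apply]
      simp [-Complex.ofReal_cos, -Complex.ofReal_sin]
    rwa [h2] at h1
  · have h1 := hdir atTop _ (tendsto_wedge_direction (θ := θ) (a := a₀) (ε := 1)
      tendsto_abs_atTop_atTop
      ((eventually_ge_atTop 0).mono fun t ht => by rw [abs_of_nonneg ht]; ring) (by norm_num))
    have h2 : slice hI ((Real.cos θ : ℂ) - (1 * Real.sin θ : ℝ) * Complex.I) =
        (Real.cos θ : ℍ) - Real.sin θ • I := by
      rw [slice_apply]
      simp [-Complex.ofReal_cos, -Complex.ofReal_sin, sub_eq_add_neg]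
    rwa [h2] at h1

/-- All path integrals in a resolvent sector converge to the same limit, which can be computed by
an integral that does not involve the imaginary unit. -/
theorem IsResolventSector.exists_limit {I : ℍ} (hI : I ∈ imaginaryUnits) {a₀ θ₀ : ℝ}
    (h : IsResolventSector T a₀ θ₀) {α : ℝ} (hα : 0 < α) :
    ∃ L : BoundedOp V,
      (∀ g, IsSectorPath θ₀ a₀ g →
        Tendsto (rightIntegral T I (fun t => slice hI (g t)) α) (atBot ×ˢ atTop) (𝓝 L) ∧
        Tendsto (leftIntegral T I (fun t => slice hI (g t)) α) (atBot ×ˢ atTop) (𝓝 L)) ∧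
      ∀ a ∈ Ioc 0 a₀, ∀ θ ∈ Ioo θ₀ Real.pi,
        Tendsto (fun R : ℝ => (2 * Real.pi)⁻¹ •
          ∫ t in 0..R, wedgeForm (planeRes T) (planeOp T) α θ a t) atTop (𝓝 L) := by
  obtain ⟨M, hM, hb⟩ := h.bound
  have hθ₀ := h.angle_mem
  have hsec : ∀ {J : ℍ} (hJ : J ∈ imaginaryUnits), ∀ z ∈ slitSector θ₀ a₀,
      slice hJ z ∈ closedSector θ₀ a₀ := fun hJ z hz => ((mem_slitSector_iff hJ hθ₀).1 hz).1
  have hsub : slitSector θ₀ a₀ ⊆ slice stdUnit_mem ⁻¹' resolventSet T := fun z hz =>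
    h.subset_resolventSet (hsec stdUnit_mem z hz)
  obtain ⟨L₁, hL₁⟩ := (isSlicePair_plane T).exists_tendsto_rightForm (sliceMul V hI)
    (norm_sliceMul_le hI) h.vertex_pos hθ₀ hsub hM.le (fun z hz => by
      have := (hb _ (hsec hI z hz)).1
      rwa [resolventR_slice, norm_slice] at this) hα
  obtain ⟨L₂, hL₂⟩ := (isSlicePair_plane T).exists_tendsto_leftForm (sliceMul V hI)
    (norm_sliceMul_le hI) h.vertex_pos hθ₀ hsub hM.le (fun z hz => by
      have := (hb _ (hsec hI z hz)).2
      rwa [resolventL_slice, norm_slice] at this) hα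
  -- Convergence with independent end points specialises to the symmetric intervals on which
  -- conjugate points pair up.
  have hdiag : Tendsto (fun R : ℝ => (-R, R)) atTop (atBot ×ˢ atTop) :=
    tendsto_neg_atTop_atBot.prodMk tendsto_id
  have hP : ∀ θ a t, planeRes T (wedge θ a (-t)) = planeRes T (wedge θ a t) := fun θ a t => by
    rw [wedge_neg, planeRes_conj]
  have hK : ∀ θ a t, planeOp T (wedge θ a (-t)) = planeOp T (wedge θ a t) := fun θ a t => by
    rw [wedge_neg, planeOp_conj]
  have hwedge : ∀ a ∈ Ioc 0 a₀, ∀ θ ∈ Ioo θ₀ Real.pi,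
      Tendsto (fun R : ℝ => ∫ t in 0..R, wedgeForm (planeRes T) (planeOp T) α θ a t) atTop (𝓝 L₁) ∧
      Tendsto (fun R : ℝ => ∫ t in 0..R, wedgeForm (planeRes T) (planeOp T) α θ a t) atTop
        (𝓝 L₂) := by
    intro a ha θ hθ
    have hp := isSectorPath_wedge ha.1 ha.2 hθ₀ hθ
    have hθ' : θ ∈ Ioo 0 Real.pi := ⟨hθ₀.1.trans hθ.1, hθ.2⟩
    obtain ⟨hi₁, ht₁⟩ := hL₁ _ hp
    obtain ⟨hi₂, ht₂⟩ := hL₂ _ hp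
    exact ⟨(ht₁.comp hdiag).congr fun R =>
        integral_rightForm_wedge ha.1 hθ' (hP θ a) (hK θ a) hi₁ R,
      (ht₂.comp hdiag).congr fun R =>
        integral_leftForm_wedge ha.1 hθ' (hP θ a) (hK θ a) hi₂ R⟩
  have hL : L₁ = L₂ := by
    obtain ⟨θ, hθ⟩ := nonempty_Ioo.2 hθ₀.2
    obtain ⟨h1, h2⟩ := hwedge a₀ ⟨h.vertex_pos, le_rfl⟩ θ hθ
    exact tendsto_nhds_unique h1 h2
  refine ⟨(2 * Real.pi)⁻¹ • L₁, fun g hg => ⟨?_, ?_⟩, fun a ha θ hθ =>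
    (hwedge a ha θ hθ).1.const_smul _⟩
  · exact ((hL₁ g hg).2.const_smul _).congr fun p =>
      (rightIntegral_slice hI α (fun t => (hg.mem t).1) p).symm
  · rw [hL]
    exact ((hL₂ g hg).2.const_smul _).congr fun p =>
      (leftIntegral_slice hI α (fun t => (hg.mem t).1) p).symm

/-- The limits along any two admissible paths agree. -/
theorem exists_limit_admissible {α : ℝ} (hα : 0 < α) {I₁ : ℍ} {γ₁ : ℝ → ℍ}
    (h₁ : IsAdmissiblePath T I₁ γ₁) :
    ∃ L : BoundedOp V, ∀ I γ, IsAdmissiblePath T I γ →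
      Tendsto (rightIntegral T I γ α) (atBot ×ˢ atTop) (𝓝 L) ∧
      Tendsto (leftIntegral T I γ α) (atBot ×ˢ atTop) (𝓝 L) := by
  obtain ⟨hI₁, a₁, θ₁, -, hs₁, -, -⟩ := h₁.exists_sectorPath
  obtain ⟨L, -, hL⟩ := hs₁.exists_limit hI₁ hα
  refine ⟨L, fun I γ h => ?_⟩
  obtain ⟨hI, a, θ, g, hs, hg, rfl⟩ := h.exists_sectorPath
  obtain ⟨L', hL', hw⟩ := hs.exists_limit hI hα
  -- An angle above both sector angles and the smaller of the two vertices give a wedge inside both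
  -- sectors.
  obtain ⟨ψ, hψ⟩ := nonempty_Ioo.2 (max_lt hs₁.angle_mem.2 hs.angle_mem.2)
  have hm : 0 < min a₁ a := lt_min hs₁.vertex_pos hs.vertex_pos
  have e1 := hL (min a₁ a) ⟨hm, min_le_left _ _⟩ ψ ⟨(le_max_left _ _).trans_lt hψ.1, hψ.2⟩
  have e2 := hw (min a₁ a) ⟨hm, min_le_right _ _⟩ ψ ⟨(le_max_right _ _).trans_lt hψ.1, hψ.2⟩
  rw [tendsto_nhds_unique e1 e2]
  exact hL' g hg

end Admissible

end QuatFrac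

theorem mainTheorem9 {V : Type*} [NormedAddCommGroup V] [NormedSpace ℝ V] [CompleteSpace V]
    [Module ℍ V] [Module ℍᵐᵒᵖ V] [SMulCommClass ℍ ℍᵐᵒᵖ V]
    [IsScalarTower ℝ ℍ V] [IsScalarTower ℝ ℍᵐᵒᵖ V]
    [NormSMulClass ℍ V] [NormSMulClass ℍᵐᵒᵖ V]
    (T : QuatFrac.ClosedOp V)
    (hT : QuatFrac.nonposReals ⊆ QuatFrac.resolventSet T)
    (M : ℝ) (hM : 0 < M)
    (hbound : ∀ s ∈ QuatFrac.nonposReals, ‖QuatFrac.resolventR T s‖ ≤ M / (1 + ‖s‖))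
    (α : ℝ) (hα : 0 < α) :
    (∃ (I : ℍ) (γ : ℝ → ℍ), QuatFrac.IsAdmissiblePath T I γ) ∧
    ∀ (I : ℍ) (γ : ℝ → ℍ), QuatFrac.IsAdmissiblePath T I γ →
      Tendsto (QuatFrac.rightIntegral T I γ α) (atBot ×ˢ atTop) (𝓝 (QuatFrac.fracPow T α)) ∧
      Tendsto (QuatFrac.leftIntegral T I γ α) (atBot ×ˢ atTop) (𝓝 (QuatFrac.fracPow T α)) := by
  open QuatFrac in
  have hex : ∃ (I : ℍ) (γ : ℝ → ℍ), IsAdmissiblePath T I γ := by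
    obtain ⟨a₀, θ₀, h⟩ := exists_isResolventSector hT hM hbound
    obtain ⟨θ, hθ⟩ := nonempty_Ioo.2 h.angle_mem.2
    exact ⟨_, _, isAdmissiblePath_wedge stdUnit_mem h hθ⟩
  refine ⟨hex, ?_⟩
  have hex' : ∃ p : ℍ × (ℝ → ℍ), QuatFrac.IsAdmissiblePath T p.1 p.2 :=
    hex.elim fun I h => h.elim fun γ hγ => ⟨(I, γ), hγ⟩
  obtain ⟨L, hL⟩ := QuatFrac.exists_limit_admissible hα hex'.choose_spec
  -- The path chosen in `fracPow` is itself admissible, so its limit is the common value L.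
  have hfrac : QuatFrac.fracPow T α = L := by
    rw [QuatFrac.fracPow, dif_pos hex']
    exact (hL _ _ hex'.choose_spec).1.limUnder_eq
  rw [hfrac]
  exact hL
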